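/- All Banach spaces are over a fixed scalar field $\mathbb K\in\{\mathbb R,\mathbb C\}$ and operators are linear and bounded. Definitions. - A Banach space $F$ is an $\mathcal L_1$-space if there is $\sigma\in[1,\infty)$ such that every finite-dimensional subspace of $F$ is contained in a finite-dimensional subspace $G$ of $F$ admitting, for some $n\ge 0$, a linear isomorphism $e:G\to\ell^1_n$ with $\|e\|\,\|e^{-1}\|\le\sigma$. - An operator $T:X\to Y$ between Banach spaces is $1$-absolutely summing if there is $C<\infty$ such that $\sum_{i}\|Tx_i\|\le C\sup\{\sum_i|\varphi(x_i)| : \varphi\in X^*,\ \|\varphi\|\le 1\}$ for every finite family $(x_i)$ in $X$. A Banach space $X$ is a GT-space if every bounded operator $X\to\ell^2$ is $1$-absolutely summing. - A twisted sum of Banach spaces $X$ and $Z$, written $Y=X\,\tilde\oplus\,Z$, is a Banach space $Y$ together with a short exact sequence $0\to X\xrightarrow{\,j\,}Y\xrightarrow{\,q\,}Z\to 0$ in which $j$ is a linear isometric embedding and $q$ is a quotient map (it maps the open unit ball of $Y$ onto the open unit ball of $Z$). It splits if there is a bounded linear $v:Z\to Y$ with $qv=\mathrm{id}_Z$. Its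 splitting constant is $$\mathrm{spl}(Y)=\inf\bigl\{(\|v\|^2+\|\mathrm{id}_Y-vq\|^2)^{1/2} : v:Z\to Y \text{ bounded linear},\ qv=\mathrm{id}_Z\bigr\},$$ with $\mathrm{spl}(Y)=+\infty$ if $Y$ does not split. **Theorem 3.1.** Let $E$ be a Banach space and let $Q$ be a bounded linear surjection from an $\mathcal L_1$-space $F$ onto $E$. Then the following conditions are equivalent: (+) $\ker Q$ is a GT-space; (++) every twisted sum $\ell^2\,\tilde\oplus\,E$ splits; (+++) $\sup \mathrm{spl}(\ell^2_n\,\tilde\oplus\,E)<+\infty$, where the supremum extends over all positive integers $n$ and all twisted sums $\ell^2_n\,\tilde\oplus\,E$ ($\ell^2_n$ being $n$-dimensional Hilbert space). -/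

import Mathlib

open scoped ENNReal NNReal

noncomputable section

/-- The Banach space `ℓ²` of square summable scalar sequences. -/
abbrev EllTwo (𝕜 : Type*) [RCLike 𝕜] : Type _ := lp (fun _ : ℕ => 𝕜) 2

/-- `F` is an `𝓛₁`-space: for some `σ ≥ 1` every finite dimensional subspace of `F` is contained in
a finite dimensional subspace which is `σ`-isomorphic to `ℓ¹ₙ` for some `n`. -/
def IsScriptLOneSpace (𝕜 : Type*) [RCLike 𝕜] (F : Type*) [NormedAddCommGroup F]
    [NormedSpace 𝕜 F] : Prop :=
  ∃ σ : ℝ, 1 ≤ σ ∧ ∀ G : Submodule 𝕜 F, FiniteDimensional 𝕜 G →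
    ∃ G' : Submodule 𝕜 F, G ≤ G' ∧ ∃ (n : ℕ) (e : G' ≃L[𝕜] PiLp 1 (fun _ : Fin n => 𝕜)),
      ‖(e : G' →L[𝕜] PiLp 1 (fun _ : Fin n => 𝕜))‖ *
        ‖(e.symm : PiLp 1 (fun _ : Fin n => 𝕜) →L[𝕜] G')‖ ≤ σ

/-- A bounded operator `T` is `1`-absolutely summing: there is `C < ∞` such that
`∑ ‖T xᵢ‖ ≤ C * sup {∑ |φ xᵢ| : φ ∈ X*, ‖φ‖ ≤ 1}` for all finite families `(xᵢ)` in `X`. -/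
def IsAbsolutelySumming {𝕜 : Type*} [RCLike 𝕜] {X Y : Type*} [NormedAddCommGroup X]
    [NormedSpace 𝕜 X] [NormedAddCommGroup Y] [NormedSpace 𝕜 Y] (T : X →L[𝕜] Y) : Prop :=
  ∃ C : ℝ≥0, ∀ (m : ℕ) (x : Fin m → X),
    ∑ i, ‖T (x i)‖ₑ ≤ C * ⨆ φ : {φ : X →L[𝕜] 𝕜 // ‖φ‖ ≤ 1}, ∑ i, ‖φ.1 (x i)‖ₑ

/-- `X` is a GT-space: every bounded operator from `X` into `ℓ²` is `1`-absolutely summing. -/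
def IsGTSpace (𝕜 : Type*) [RCLike 𝕜] (X : Type*) [NormedAddCommGroup X] [NormedSpace 𝕜 X] :
    Prop :=
  ∀ T : X →L[𝕜] EllTwo 𝕜, IsAbsolutelySumming T

universe u v w

/-- A twisted sum of the Banach spaces `X` and `Z`: a Banach space `Y` (`space`) with a short exact
sequence `0 → X → Y → Z → 0` whose first map is an isometric embedding and whose second map is a
(metric) quotient map, i.e. carries the open unit ball of `Y` onto the open unit ball of `Z`.
The set underlying `Y` is in bijection with `X × Z`, so the universe of `X × Z` suffices. -/
structure TwistedSum (𝕜 : Type w) [RCLike 𝕜] (X : Type u) (Z : Type v) [NormedAddCommGroup X]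
    [NormedSpace 𝕜 X] [NormedAddCommGroup Z] [NormedSpace 𝕜 Z] where
  space : Type (max u v)
  [normedAddCommGroup : NormedAddCommGroup space]
  [normedSpace : NormedSpace 𝕜 space]
  [completeSpace : CompleteSpace space]
  j : X →ₗᵢ[𝕜] space
  q : space →L[𝕜] Z
  range_j : LinearMap.range j.toLinearMap = LinearMap.ker q.toLinearMap
  quotient_q : q '' Metric.ball 0 1 = Metric.ball 0 1

attribute [instance] TwistedSum.normedAddCommGroup TwistedSum.normedSpace
  TwistedSum.completeSpace

namespace TwistedSum

variable {𝕜 : Type w} [RCLike 𝕜] {X : Type u} {Z : Type v} [NormedAddCommGroup X]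
  [NormedSpace 𝕜 X] [NormedAddCommGroup Z] [NormedSpace 𝕜 Z]

/-- A twisted sum splits if its quotient map has a bounded linear right inverse. -/
def Splits (Y : TwistedSum 𝕜 X Z) : Prop :=
  ∃ v : Z →L[𝕜] Y.space, Y.q ∘L v = ContinuousLinearMap.id 𝕜 Z

/-- The splitting constant of a twisted sum: the infimum of `(‖v‖² + ‖id - v q‖²)^(1/2)` over all
bounded linear right inverses `v` of `q`; it is `∞` if there are none. -/
def spl (Y : TwistedSum 𝕜 X Z) : ℝ≥0∞ :=
  ⨅ v : {v : Z →L[𝕜] Y.space // Y.q ∘L v = ContinuousLinearMap.id 𝕜 Z},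
    ENNReal.ofReal (Real.sqrt
      (‖v.1‖ ^ 2 + ‖ContinuousLinearMap.id 𝕜 Y.space - v.1 ∘L Y.q‖ ^ 2))

end TwistedSum

end

-- Let `K` be the kernel of `Q` and `H` a Hilbert space. The theorem compares two questions: which
-- operators `K → H` extend to `F`, and which twisted sums of `H` and `E` split.
--
-- Given a twisted sum `Y` with quotient map `q`, `Q` lifts to `G : F → Y` with `q G = Q`. This is
-- Lindenstrauss lifting: the `𝓛₁`-structure gives local lifts, and weak compactness in `H` glues
-- them. `G` maps `K` into `H`. If that restriction extends to `T' : F → H`, then `G - T'` kills `K`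
-- and descends to a right inverse of `q`; conversely, for a right inverse `v`, `G - v Q` takes
-- values in `H` and extends the restriction. Every operator `K → H` arises so, up to a scalar
-- factor, from a push-out. Hence splitting amounts to extending operators from `K`, with norm
-- control both ways.
--
-- Extending amounts to being summing. By Grothendieck's theorem operators from `F` to a Hilbert
-- space are summing, hence so are their restrictions to `K`. Conversely, Pietsch domination bounds
-- a summing operator on `K` by a semi-inner product defined on all of `F`, where an orthogonal
-- projection extends it.
--
-- The passage between `ℓ²` and all `ℓ²ₙ` uses coordinate truncations together with a uniform
-- extension constant, which comes from the open mapping theorem.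

universe t

/-! ### Fourth moments of sign sums and Grothendieck's inequality -/

/-- A normalised random sign sum: an isometric copy of `𝕜^N` inside a finite dimensional `L²`-space
on which the fourth moment is controlled by the second one. -/
theorem exists_fourth_moment_embedding (𝕜 : Type*) [RCLike 𝕜] (N : ℕ) :
    ∃ (k : ℕ) (_ : 0 < k) (J : (Fin N → 𝕜) →ₗ[𝕜] (Fin k → 𝕜)),
      (∀ x, ∑ ω, ‖J x ω‖ ^ 2 = k * ∑ i, ‖x i‖ ^ 2) ∧
      ∀ x, ∑ ω, ‖J x ω‖ ^ 4 ≤ 3 * k * (∑ i, ‖x i‖ ^ 2) ^ 2 := by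
  induction N with
  | zero =>
    exact ⟨1, one_pos, 0, by simp, by simp⟩
  | succ N ih =>
    obtain ⟨k, hk, J, h2, h4⟩ := ih
    let tl : (Fin (N + 1) → 𝕜) →ₗ[𝕜] (Fin N → 𝕜) := LinearMap.funLeft 𝕜 𝕜 Fin.succ
    let c : (Fin (N + 1) → 𝕜) →ₗ[𝕜] (Fin k → 𝕜) :=
      LinearMap.pi fun _ => LinearMap.proj 0
    -- One more independent sign doubles the sample space: the new coordinate is added on one copy
    -- and subtracted on the other. Thus `k` is `2 ^ N`.
    let A : (Fin (N + 1) → 𝕜) →ₗ[𝕜] (Fin k ⊕ Fin k → 𝕜) := LinearMap.pi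
      (Sum.elim (fun ω => LinearMap.proj ω ∘ₗ (J ∘ₗ tl + c))
        (fun ω => LinearMap.proj ω ∘ₗ (J ∘ₗ tl - c)))
    let J' := LinearMap.funLeft 𝕜 𝕜 (finSumFinEquiv (m := k) (n := k)).symm ∘ₗ A
    have hsum : ∀ x (p : ℕ), ∑ ω, ‖J' x ω‖ ^ p =
        ∑ ω, (‖J (tl x) ω + x 0‖ ^ p + ‖J (tl x) ω - x 0‖ ^ p) := by
      intro x p
      have hJ : ∀ b, J' x (finSumFinEquiv b) = A x b := fun b =>
        congrArg (A x) (finSumFinEquiv.symm_apply_apply b)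
      simp only [← finSumFinEquiv.sum_comp, hJ, Fintype.sum_sum_type, Finset.sum_add_distrib]
      simp [A, c]
    have hs : ∀ x : Fin (N + 1) → 𝕜, ∑ i, ‖x i‖ ^ 2 = ‖x 0‖ ^ 2 + ∑ i, ‖tl x i‖ ^ 2 := by
      intro x
      rw [Fin.sum_univ_succ]
      simp [tl, LinearMap.funLeft]
    have par : ∀ a b : 𝕜, ‖a + b‖ ^ 2 + ‖a - b‖ ^ 2 = 2 * (‖a‖ ^ 2 + ‖b‖ ^ 2) := by
      intro a b
      have := parallelogram_law_with_norm 𝕜 a b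
      nlinarith
    refine ⟨k + k, by omega, J', fun x => ?_, fun x => ?_⟩
    · rw [hsum, hs, Finset.sum_congr rfl fun ω _ => par _ _, ← Finset.mul_sum,
        Finset.sum_add_distrib, h2]
      simp
      ring
    · rw [hsum, hs]
      -- With `p = ‖a + b‖²` and `q = ‖a - b‖²`, use `2(p² + q²) = (p + q)² + (p - q)²`: the
      -- parallelogram law gives `p + q`, Cauchy–Schwarz bounds `|p - q|`.
      have key : ∀ a b : 𝕜, ‖a + b‖ ^ 4 + ‖a - b‖ ^ 4 ≤
          2 * ‖a‖ ^ 4 + 12 * ‖b‖ ^ 2 * ‖a‖ ^ 2 + 2 * ‖b‖ ^ 4 := by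
        intro a b
        have h1 := par a b
        have h3 : |‖a + b‖ ^ 2 - ‖a - b‖ ^ 2| ≤ 4 * (‖a‖ * ‖b‖) := by
          have e1 := @norm_add_sq 𝕜 𝕜 _ _ _ a b
          have e2 := @norm_sub_sq 𝕜 𝕜 _ _ _ a b
          have e3 := abs_le.1 ((RCLike.abs_re_le_norm _).trans (norm_inner_le_norm (𝕜 := 𝕜) a b))
          rw [abs_le]
          constructor <;> linarith [e3.1, e3.2]
        have h5 := sq_le_sq' (abs_le.1 h3).1 (abs_le.1 h3).2
        nlinarith
      calc ∑ ω, (‖J (tl x) ω + x 0‖ ^ 4 + ‖J (tl x) ω - x 0‖ ^ 4)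
          ≤ ∑ ω, (2 * ‖J (tl x) ω‖ ^ 4 + 12 * ‖x 0‖ ^ 2 * ‖J (tl x) ω‖ ^ 2 + 2 * ‖x 0‖ ^ 4) :=
            Finset.sum_le_sum fun ω _ => key _ _
        _ = 2 * ∑ ω, ‖J (tl x) ω‖ ^ 4 + 12 * ‖x 0‖ ^ 2 * ∑ ω, ‖J (tl x) ω‖ ^ 2
              + k * (2 * ‖x 0‖ ^ 4) := by
            simp [Finset.sum_add_distrib, Finset.mul_sum]
        _ ≤ _ := by
            rw [h2]
            have := h4 (tl x)
            have hk' : (0 : ℝ) ≤ k * ‖x 0‖ ^ 4 := by positivity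
            push_cast
            nlinarith

/-- Every vector of a Euclidean space splits, after an isometric embedding, into a uniformly bounded
function and a function of small norm. -/
theorem exists_truncation (𝕜 : Type*) [RCLike 𝕜] (N : ℕ) :
    ∃ (k : ℕ) (_ : 0 < k) (J : EuclideanSpace 𝕜 (Fin N) →ₗᵢ[𝕜] EuclideanSpace 𝕜 (Fin k)),
      ∀ x, ‖x‖ ≤ 1 → ∃ y z : EuclideanSpace 𝕜 (Fin k), J x = y + z ∧ ‖y‖ ≤ 1 ∧ ‖z‖ ≤ 1 / 4 ∧
        ∀ ω, ‖y ω‖ ^ 2 ≤ 48 / k := by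
  obtain ⟨k, hk, J, h2, h4⟩ := exists_fourth_moment_embedding 𝕜 N
  have hk0 : (0 : ℝ) < k := by exact_mod_cast hk
  let s : 𝕜 := ((√k : ℝ) : 𝕜)⁻¹
  have hs : ‖s‖ ^ 2 = (k : ℝ)⁻¹ := by
    simp [s, abs_of_nonneg (Real.sqrt_nonneg _), Real.sq_sqrt hk0.le]
  let L : EuclideanSpace 𝕜 (Fin N) →ₗ[𝕜] EuclideanSpace 𝕜 (Fin k) :=
    s • ((WithLp.linearEquiv 2 𝕜 (Fin k → 𝕜)).symm.toLinearMap ∘ₗ J ∘ₗ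
      (WithLp.linearEquiv 2 𝕜 (Fin N → 𝕜)).toLinearMap)
  have hL : ∀ x ω, L x ω = s * J (WithLp.ofLp x) ω := fun x ω => by simp [L]
  have hsq : ∀ x ω, ‖L x ω‖ ^ 2 = (k : ℝ)⁻¹ * ‖J (WithLp.ofLp x) ω‖ ^ 2 := fun x ω => by
    rw [hL, norm_mul, mul_pow, hs]
  have hn : ∀ x, ‖L x‖ = ‖x‖ := by
    intro x
    rw [← sq_eq_sq₀ (norm_nonneg _) (norm_nonneg _), EuclideanSpace.norm_sq_eq,
      EuclideanSpace.norm_sq_eq, Finset.sum_congr rfl fun ω _ => hsq x ω, ← Finset.mul_sum, h2,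
      ← mul_assoc, inv_mul_cancel₀ hk0.ne', one_mul]
  refine ⟨k, hk, ⟨L, hn⟩, fun x hx => ?_⟩
  have hx1 : ∑ i, ‖x i‖ ^ 2 ≤ 1 := by
    rw [← EuclideanSpace.norm_sq_eq]; nlinarith [norm_nonneg x]
  have hx0 : 0 ≤ ∑ i, ‖x i‖ ^ 2 := by positivity
  have hfour : ∑ ω, ‖L x ω‖ ^ 4 ≤ 3 / k := by
    have e : ∀ ω, ‖L x ω‖ ^ 4 = ((k : ℝ)⁻¹) ^ 2 * ‖J (WithLp.ofLp x) ω‖ ^ 4 := fun ω => by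
      rw [show ‖L x ω‖ ^ 4 = (‖L x ω‖ ^ 2) ^ 2 by ring, hsq]; ring
    rw [Finset.sum_congr rfl fun ω _ => e ω, ← Finset.mul_sum]
    calc _ ≤ ((k : ℝ)⁻¹) ^ 2 * (3 * k * (∑ i, ‖x i‖ ^ 2) ^ 2) := by gcongr; exact h4 _
      _ ≤ ((k : ℝ)⁻¹) ^ 2 * (3 * k * 1 ^ 2) := by gcongr
      _ = 3 / k := by field_simp
  -- Truncation at squared height `48 / k`. Above it, `‖L x ω‖² ≤ (k / 48) ‖L x ω‖⁴`, so the tail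
  -- has squared norm at most `(k / 48)(3 / k) = (1 / 4)²`.
  refine ⟨WithLp.toLp 2 fun ω => if ‖L x ω‖ ^ 2 ≤ 48 / k then L x ω else 0,
    WithLp.toLp 2 fun ω => if ‖L x ω‖ ^ 2 ≤ 48 / k then 0 else L x ω, ?_, ?_, ?_, ?_⟩
  · ext ω
    change L x ω = _
    simp only [PiLp.add_apply]
    split_ifs <;> simp
  · refine le_trans ?_ ((hn x).le.trans hx)
    rw [← sq_le_sq₀ (norm_nonneg _) (norm_nonneg _), EuclideanSpace.norm_sq_eq,
      EuclideanSpace.norm_sq_eq]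
    refine Finset.sum_le_sum fun ω _ => ?_
    simp only
    split_ifs
    · exact le_rfl
    · simp
  · rw [← sq_le_sq₀ (norm_nonneg _) (by norm_num), EuclideanSpace.norm_sq_eq]
    have : ∀ ω, ‖(if ‖L x ω‖ ^ 2 ≤ 48 / k then 0 else L x ω : 𝕜)‖ ^ 2 ≤ k / 48 * ‖L x ω‖ ^ 4 := by
      intro ω
      split_ifs with h
      · simp; positivity
      · have h' : 1 ≤ k / 48 * ‖L x ω‖ ^ 2 := by
          rw [not_le, div_lt_iff₀ hk0] at h
          linarith
        nlinarith [sq_nonneg ‖L x ω‖]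
    calc _ ≤ ∑ ω, k / 48 * ‖L x ω‖ ^ 4 := Finset.sum_le_sum fun ω _ => this ω
      _ = k / 48 * ∑ ω, ‖L x ω‖ ^ 4 := by rw [Finset.mul_sum]
      _ ≤ k / 48 * (3 / k) := by gcongr
      _ = (1 / 4) ^ 2 := by field_simp; norm_num
  · intro ω
    simp only
    split_ifs with h
    · exact h
    · simp; positivity

/-- **Grothendieck's inequality** (with the non-optimal constant `96`). -/
theorem grothendieck_inequality {𝕜 : Type*} [RCLike 𝕜] {m n : ℕ} (a : Fin m → Fin n → 𝕜) (c : ℝ)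
    (ha : ∀ (s : Fin m → 𝕜) (t : Fin n → 𝕜), (∀ i, ‖s i‖ ≤ 1) → (∀ j, ‖t j‖ ≤ 1) →
      ‖∑ i, ∑ j, a i j * (s i * t j)‖ ≤ c)
    {N : ℕ} (x : Fin m → EuclideanSpace 𝕜 (Fin N)) (y : Fin n → EuclideanSpace 𝕜 (Fin N))
    (hx : ∀ i, ‖x i‖ ≤ 1) (hy : ∀ j, ‖y j‖ ≤ 1) :
    ‖∑ i, ∑ j, a i j * inner 𝕜 (x i) (y j)‖ ≤ 96 * c := by
  let Φ : ∀ N : ℕ, (Fin m → EuclideanSpace 𝕜 (Fin N)) → (Fin n → EuclideanSpace 𝕜 (Fin N)) → 𝕜 :=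
    fun N x y => ∑ i, ∑ j, a i j * inner 𝕜 (x i) (y j)
  -- The supremum runs over all dimensions at once, because truncation moves the vectors to a larger
  -- space.
  let S : Set ℝ := {r | ∃ (N : ℕ) (x : Fin m → EuclideanSpace 𝕜 (Fin N))
    (y : Fin n → EuclideanSpace 𝕜 (Fin N)), (∀ i, ‖x i‖ ≤ 1) ∧ (∀ j, ‖y j‖ ≤ 1) ∧ r = ‖Φ N x y‖}
  have hbdd : BddAbove S := by
    refine ⟨∑ i, ∑ j, ‖a i j‖, ?_⟩
    rintro _ ⟨N, x, y, hx, hy, rfl⟩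
    refine (norm_sum_le _ _).trans (Finset.sum_le_sum fun i _ => (norm_sum_le _ _).trans
      (Finset.sum_le_sum fun j _ => ?_))
    rw [norm_mul]
    refine mul_le_of_le_one_right (norm_nonneg _) ((norm_inner_le_norm _ _).trans ?_)
    exact mul_le_one₀ (hx i) (norm_nonneg _) (hy j)
  have hle : ∀ (N : ℕ) (x : Fin m → EuclideanSpace 𝕜 (Fin N))
      (y : Fin n → EuclideanSpace 𝕜 (Fin N)), (∀ i, ‖x i‖ ≤ 1) → (∀ j, ‖y j‖ ≤ 1) →
      ‖Φ N x y‖ ≤ sSup S := fun N x y hx hy => le_csSup hbdd ⟨N, x, y, hx, hy, rfl⟩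
  have hne : S.Nonempty := ⟨_, N, x, y, hx, hy, rfl⟩
  have hsmulr : ∀ N x y (r : 𝕜), Φ N x (fun j => r • y j) = r * Φ N x y := by
    intro N x y r
    simp only [Φ, inner_smul_right, Finset.mul_sum]
    exact Finset.sum_congr rfl fun i _ => Finset.sum_congr rfl fun j _ => by ring
  have hsmull : ∀ N x y (r : 𝕜), Φ N (fun i => r • x i) y = (starRingEnd 𝕜) r * Φ N x y := by
    intro N x y r
    simp only [Φ, inner_smul_left, Finset.mul_sum]
    exact Finset.sum_congr rfl fun i _ => Finset.sum_congr rfl fun j _ => by ring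
  have hscale : ∀ {N : ℕ} {v : EuclideanSpace 𝕜 (Fin N)}, ‖v‖ ≤ 1 / 4 → ‖(4 : 𝕜) • v‖ ≤ 1 := by
    intro N v hv
    rw [norm_smul, RCLike.norm_ofNat]
    linarith
  -- Self-improvement: the bounded parts reduce to scalars coordinatewise and cost `48 * c`; each of
  -- the two error terms has a factor of norm at most `1 / 4` and costs a quarter of the supremum.
  -- As the supremum is finite, it is at most `96 * c`.
  have hmain : ∀ r ∈ S, r ≤ 48 * c + sSup S / 2 := by
    rintro _ ⟨N, x, y, hx, hy, rfl⟩
    obtain ⟨k, hk, J, hJ⟩ := exists_truncation 𝕜 N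
    have hk0 : (0 : ℝ) < k := by exact_mod_cast hk
    choose x₁ x₂ hxa hx₁ hx₂ hxb using fun i => hJ (x i) (hx i)
    choose y₁ y₂ hya hy₁ hy₂ hyb using fun j => hJ (y j) (hy j)
    have hdec : Φ N x y = Φ k x₁ y₁ + (Φ k x₂ (fun j => J (y j)) + Φ k x₁ y₂) := by
      simp only [Φ, ← Finset.sum_add_distrib]
      refine Finset.sum_congr rfl fun i _ => Finset.sum_congr rfl fun j _ => ?_
      rw [← J.inner_map_map, hxa, hya]
      simp only [inner_add_left, inner_add_right]
      ring
    have hA : ‖Φ k x₁ y₁‖ ≤ 48 * c := by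
      have hk1 : ‖((√(48 / k) : ℝ) : 𝕜)‖ ^ 2 = 48 / k := by
        rw [RCLike.norm_ofReal, sq_abs, Real.sq_sqrt (by positivity)]
      set R : 𝕜 := ((√(48 / k) : ℝ) : 𝕜) with hR
      have hR0 : R ≠ 0 := by
        intro h
        have h48 : (0 : ℝ) < 48 / k := by positivity
        rw [← hk1, h] at h48
        simp at h48
      have hb : ∀ v : EuclideanSpace 𝕜 (Fin k), (∀ ω, ‖v ω‖ ^ 2 ≤ 48 / k) →
          ∀ ω, ‖v ω / R‖ ≤ 1 := by
        intro v hv ω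
        rw [norm_div, div_le_one (norm_pos_iff.2 hR0),
          ← sq_le_sq₀ (norm_nonneg _) (norm_nonneg _), hk1]
        exact hv ω
      have e : Φ k x₁ y₁ = ∑ ω, ((starRingEnd 𝕜) R * R) * ∑ i, ∑ j,
          a i j * ((starRingEnd 𝕜) (x₁ i ω / R) * (y₁ j ω / R)) := by
        simp only [Φ, PiLp.inner_apply, Finset.mul_sum]
        rw [Finset.sum_comm]
        rw [Finset.sum_comm]
        conv_rhs => rw [Finset.sum_comm]
        refine Finset.sum_congr rfl fun i _ => ?_
        conv_rhs => rw [Finset.sum_comm]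
        refine Finset.sum_congr rfl fun j _ => Finset.sum_congr rfl fun ω _ => ?_
        have hR1 : (starRingEnd 𝕜) R ≠ 0 := by simpa using hR0
        simp only [RCLike.inner_apply, map_div₀]
        field_simp
      rw [e]
      calc _ ≤ ∑ ω : Fin k, (48 / k) * c := by
            refine (norm_sum_le _ _).trans (Finset.sum_le_sum fun ω _ => ?_)
            rw [norm_mul, norm_mul, RCLike.norm_conj, ← sq, hk1]
            gcongr
            refine ha (fun i => (starRingEnd 𝕜) (x₁ i ω / R)) (fun j => y₁ j ω / R) ?_ ?_
            · intro i
              rw [RCLike.norm_conj]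
              exact hb _ (hxb i) ω
            · exact fun j => hb _ (hyb j) ω
        _ = 48 * c := by
            simp
            field_simp
    have hB : ‖Φ k x₂ (fun j => J (y j))‖ ≤ sSup S / 4 := by
      have := hle k (fun i => (4 : 𝕜) • x₂ i) (fun j => J (y j)) (fun i => hscale (hx₂ i))
        (fun j => (J.norm_map _).trans_le (hy j))
      rw [hsmull, norm_mul, RCLike.norm_conj, RCLike.norm_ofNat] at this
      linarith
    have hC : ‖Φ k x₁ y₂‖ ≤ sSup S / 4 := by
      have := hle k x₁ (fun j => (4 : 𝕜) • y₂ j) hx₁ (fun i => hscale (hy₂ i))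
      rw [hsmulr, norm_mul, RCLike.norm_ofNat] at this
      linarith
    rw [hdec]
    linarith [norm_add₃_le (a := Φ k x₁ y₁) (b := Φ k x₂ (fun j => J (y j))) (c := Φ k x₁ y₂),
      norm_add_le (Φ k x₁ y₁) (Φ k x₂ (fun j => J (y j)) + Φ k x₁ y₂),
      norm_add_le (Φ k x₂ (fun j => J (y j))) (Φ k x₁ y₂)]
  have := csSup_le hne hmain
  linarith [hle N x y hx hy]

/-! ### Summing operators and Grothendieck's theorem -/

/-- `C` bounds the `1`-summing constant of `T`. -/
def SummingBound {𝕜 : Type*} [RCLike 𝕜] {X Y : Type*} [NormedAddCommGroup X]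
    [NormedSpace 𝕜 X] [NormedAddCommGroup Y] [NormedSpace 𝕜 Y] (T : X →L[𝕜] Y) (C : ℝ) : Prop :=
  ∀ (m : ℕ) (x : Fin m → X) (c : ℝ), (∀ φ : X →L[𝕜] 𝕜, ‖φ‖ ≤ 1 → ∑ i, ‖φ (x i)‖ ≤ c) →
    ∑ i, ‖T (x i)‖ ≤ C * c

theorem isAbsolutelySumming_iff_exists_summingBound {𝕜 : Type*} [RCLike 𝕜] {X Y : Type*}
    [NormedAddCommGroup X] [NormedSpace 𝕜 X] [NormedAddCommGroup Y] [NormedSpace 𝕜 Y]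
    (T : X →L[𝕜] Y) : IsAbsolutelySumming T ↔ ∃ C : ℝ, 0 ≤ C ∧ SummingBound T C := by
  have hE : ∀ {Z : Type _} [NormedAddCommGroup Z] {m : ℕ} (z : Fin m → Z),
      ∑ i, ‖z i‖ₑ = ENNReal.ofReal (∑ i, ‖z i‖) := by
    intro Z _ m z
    rw [ENNReal.ofReal_sum_of_nonneg fun i _ => norm_nonneg _]
    simp
  have hE' : ∀ {m : ℕ} (z : Fin m → 𝕜), ∑ i, ‖z i‖ₑ = ENNReal.ofReal (∑ i, ‖z i‖) := by
    intro m z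
    rw [ENNReal.ofReal_sum_of_nonneg fun i _ => norm_nonneg _]
    simp
  constructor
  · rintro ⟨C, hC⟩
    refine ⟨C, C.2, fun m x c hc => ?_⟩
    have hc0 : 0 ≤ c := by simpa using hc 0 (by simp)
    have h := hC m x
    have hsup : (⨆ φ : {φ : X →L[𝕜] 𝕜 // ‖φ‖ ≤ 1}, ∑ i, ‖φ.1 (x i)‖ₑ) ≤ ENNReal.ofReal c := by
      refine iSup_le fun φ => ?_
      rw [hE']
      exact ENNReal.ofReal_le_ofReal (hc φ.1 φ.2)
    have h' := h.trans (mul_le_mul_right hsup _)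
    rw [hE, ← ENNReal.ofReal_coe_nnreal, ← ENNReal.ofReal_mul C.coe_nonneg] at h'
    exact (ENNReal.ofReal_le_ofReal_iff (mul_nonneg C.coe_nonneg hc0)).1 h'
  · rintro ⟨C, hC0, hC⟩
    lift C to ℝ≥0 using hC0
    refine ⟨C, fun m x => ?_⟩
    set S := ⨆ φ : {φ : X →L[𝕜] 𝕜 // ‖φ‖ ≤ 1}, ∑ i, ‖φ.1 (x i)‖ₑ with hS
    -- The weak supremum is at most `∑ ‖x i‖`, so it can be used as a real bound.
    have hfin : S ≠ ⊤ := by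
      refine ne_top_of_le_ne_top (ENNReal.ofReal_ne_top (r := ∑ i, ‖x i‖)) (iSup_le fun φ => ?_)
      rw [hE']
      refine ENNReal.ofReal_le_ofReal (Finset.sum_le_sum fun i _ => ?_)
      exact (φ.1.le_of_opNorm_le φ.2 _).trans_eq (one_mul _)
    have := hC m x S.toReal fun φ hφ => by
      rw [← ENNReal.ofReal_le_iff_le_toReal hfin, ← hE']
      exact le_iSup (fun φ : {φ : X →L[𝕜] 𝕜 // ‖φ‖ ≤ 1} => ∑ i, ‖φ.1 (x i)‖ₑ) ⟨φ, hφ⟩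
    rw [hE]
    refine (ENNReal.ofReal_le_ofReal this).trans ?_
    rw [ENNReal.ofReal_mul C.coe_nonneg, ENNReal.ofReal_toReal hfin, ENNReal.ofReal_coe_nnreal]

/-- A bound on weak sums over the unit ball of the dual scales with the norm of the functional. -/
theorem sum_norm_apply_le_of_unit_ball {𝕜 : Type*} [RCLike 𝕜] {X : Type*}
    [NormedAddCommGroup X] [NormedSpace 𝕜 X] {m : ℕ} {x : Fin m → X} {c : ℝ}
    (hc : ∀ φ : X →L[𝕜] 𝕜, ‖φ‖ ≤ 1 → ∑ i, ‖φ (x i)‖ ≤ c) (φ : X →L[𝕜] 𝕜) :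
    ∑ i, ‖φ (x i)‖ ≤ ‖φ‖ * c := by
  by_cases h : ‖φ‖ = 0
  · have : φ = 0 := norm_eq_zero.1 h
    simp [this]
  · have hpos : 0 < ‖φ‖ := lt_of_le_of_ne (norm_nonneg _) (Ne.symm h)
    have h1 := hc (((‖φ‖ : ℝ) : 𝕜)⁻¹ • φ) (by
      rw [norm_smul, norm_inv, RCLike.norm_ofReal, abs_norm, inv_mul_cancel₀ h])
    simp only [smul_apply, norm_smul, norm_inv, RCLike.norm_ofReal, abs_norm,
      ← Finset.mul_sum] at h1
    rwa [inv_mul_le_iff₀ hpos] at h1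

/-- **Grothendieck's theorem**: operators from `ℓ¹ₙ` into a Euclidean space are summing, with a
uniform constant. -/
theorem sum_norm_le_of_piLp_one {𝕜 : Type*} [RCLike 𝕜] {n N m : ℕ}
    (T : PiLp 1 (fun _ : Fin n => 𝕜) →L[𝕜] EuclideanSpace 𝕜 (Fin N))
    (u : Fin m → PiLp 1 (fun _ : Fin n => 𝕜)) (c : ℝ)
    (hc : ∀ t : Fin n → 𝕜, (∀ j, ‖t j‖ ≤ 1) → ∑ i, ‖∑ j, t j * u i j‖ ≤ c) :
    ∑ i, ‖T (u i)‖ ≤ 96 * ‖T‖ * c := by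
  by_cases hT : ‖T‖ = 0
  · have : T = 0 := norm_eq_zero.1 hT
    simp [this]
  have hpos : 0 < ‖T‖ := lt_of_le_of_ne (norm_nonneg _) (Ne.symm hT)
  let b : Fin n → PiLp 1 (fun _ : Fin n => 𝕜) := fun j => WithLp.toLp 1 (Pi.single j 1)
  have hb : ∀ j, ‖b j‖ ≤ 1 := fun j => by
    simp [b]
  have hu : ∀ i, u i = ∑ j, u i j • b j := by
    intro i
    ext k
    rw [WithLp.ofLp_sum, Finset.sum_apply]
    simp [b]
  -- Normalised so that `⟪y i, T (u i)⟫ = ‖T (u i)‖`. If `T (u i) = 0`, the convention `0⁻¹ = 0`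
  -- gives `y i = 0`, which is harmless.
  let y : Fin m → EuclideanSpace 𝕜 (Fin N) := fun i => ((‖T (u i)‖ : ℝ) : 𝕜)⁻¹ • T (u i)
  let z : Fin n → EuclideanSpace 𝕜 (Fin N) := fun j => ((‖T‖ : ℝ) : 𝕜)⁻¹ • T (b j)
  have hy : ∀ i, ‖y i‖ ≤ 1 := fun i => by
    rw [norm_smul, norm_inv, RCLike.norm_ofReal, abs_norm]
    exact inv_mul_le_one
  have hz : ∀ j, ‖z j‖ ≤ 1 := fun j => by
    rw [norm_smul, norm_inv, RCLike.norm_ofReal, abs_norm, inv_mul_le_iff₀ hpos]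
    exact T.le_opNorm_of_le (hb j)
  have hyT : ∀ i, inner 𝕜 (y i) (T (u i)) = ((‖T (u i)‖ : ℝ) : 𝕜) := by
    intro i
    by_cases h : ‖T (u i)‖ = 0
    · simp [y, norm_eq_zero.1 h]
    · have h' : ((‖T (u i)‖ : ℝ) : 𝕜) ≠ 0 := by exact_mod_cast h
      simp only [y, inner_smul_left, inner_self_eq_norm_sq_to_K, map_inv₀, RCLike.conj_ofReal]
      field_simp
  have hG := grothendieck_inequality (fun i j => u i j) c (fun s t hs ht => by
    refine le_trans ?_ (hc t ht)
    refine (norm_sum_le _ _).trans (Finset.sum_le_sum fun i _ => ?_)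
    have e : ∑ j, u i j * (s i * t j) = s i * ∑ j, t j * u i j := by
      rw [Finset.mul_sum]
      exact Finset.sum_congr rfl fun j _ => by ring
    rw [e, norm_mul]
    exact mul_le_of_le_one_left (norm_nonneg _) (hs i)) y z hy hz
  have e : ∑ i, ∑ j, u i j * inner 𝕜 (y i) (z j) =
      ((‖T‖⁻¹ * ∑ i, ‖T (u i)‖ : ℝ) : 𝕜) := by
    rw [Finset.mul_sum, RCLike.ofReal_sum]
    refine Finset.sum_congr rfl fun i _ => ?_
    rw [RCLike.ofReal_mul, ← hyT i, RCLike.ofReal_inv]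
    conv_rhs => rw [hu i]
    simp only [map_sum, map_smul, inner_sum, inner_smul_right, Finset.mul_sum, z]
    exact Finset.sum_congr rfl fun j _ => by ring
  rw [e, RCLike.norm_ofReal, abs_of_nonneg (by positivity), inv_mul_le_iff₀ hpos] at hG
  linarith

/-- Operators from an `𝓛₁`-space into Euclidean spaces are summing, with a uniform constant. -/
theorem IsScriptLOneSpace.exists_summingBound {𝕜 : Type*} [RCLike 𝕜] {F : Type*}
    [NormedAddCommGroup F] [NormedSpace 𝕜 F] (hF : IsScriptLOneSpace 𝕜 F) :
    ∃ C : ℝ, 0 ≤ C ∧ ∀ (N : ℕ) (T : F →L[𝕜] EuclideanSpace 𝕜 (Fin N)),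
      SummingBound T (C * ‖T‖) := by
  obtain ⟨σ, hσ, hF⟩ := hF
  refine ⟨96 * σ, by positivity, fun N T m x c hc => ?_⟩
  obtain ⟨G, hG, n, e, he⟩ := hF (Submodule.span 𝕜 (Set.range x))
    (FiniteDimensional.span_of_finite 𝕜 (Set.finite_range x))
  have hx : ∀ i, x i ∈ G := fun i => hG (Submodule.subset_span ⟨i, rfl⟩)
  have hc0 : 0 ≤ c := by simpa using hc 0 (by simp)
  set E₁ : G →L[𝕜] PiLp 1 (fun _ : Fin n => 𝕜) :=
    (e : G →L[𝕜] PiLp 1 (fun _ : Fin n => 𝕜)) with hE₁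
  set E₂ : PiLp 1 (fun _ : Fin n => 𝕜) →L[𝕜] G :=
    (e.symm : PiLp 1 (fun _ : Fin n => 𝕜) →L[𝕜] G) with hE₂
  have h := sum_norm_le_of_piLp_one (T ∘L G.subtypeL ∘L E₂) (fun i => E₁ ⟨x i, hx i⟩)
    (‖E₁‖ * c) (by
      intro t ht
      -- Unimodularly bounded coefficients are functionals in the dual ball of `ℓ¹ₙ`. Pulled back to
      -- `G` and extended by Hahn–Banach, they are tested by the weak bound in `F`.
      let τ : PiLp 1 (fun _ : Fin n => 𝕜) →L[𝕜] 𝕜 :=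
        LinearMap.mkContinuous (∑ j, t j • (LinearMap.proj j ∘ₗ
          (WithLp.linearEquiv 1 𝕜 (Fin n → 𝕜)).toLinearMap)) 1 (by
          intro v
          rw [one_mul, PiLp.norm_eq_of_L1, LinearMap.sum_apply]
          refine (norm_sum_le _ _).trans (Finset.sum_le_sum fun j _ => ?_)
          simpa using mul_le_of_le_one_left (norm_nonneg _) (ht j))
      have hτ : ‖τ‖ ≤ 1 := LinearMap.mkContinuous_norm_le _ zero_le_one _
      obtain ⟨φ, hφ, hφn⟩ := exists_extension_norm_eq G (τ ∘L E₁)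
      have h1 : ∀ i, ∑ j, t j * E₁ ⟨x i, hx i⟩ j = φ (x i) := by
        intro i
        rw [hφ ⟨x i, hx i⟩]
        simp [τ, LinearMap.sum_apply]
      simp only [h1]
      refine (sum_norm_apply_le_of_unit_ball hc φ).trans ?_
      rw [hφn]
      gcongr
      refine (τ.opNorm_comp_le E₁).trans ?_
      exact mul_le_of_le_one_left (norm_nonneg _) hτ)
  have h2 : ∀ i, (T ∘L G.subtypeL ∘L E₂) (E₁ ⟨x i, hx i⟩) = T (x i) := by
    intro i
    simp [E₁, E₂]
  simp only [h2] at h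
  refine h.trans ?_
  have h3 : ‖T ∘L G.subtypeL ∘L E₂‖ ≤ ‖T‖ * ‖E₂‖ := by
    refine (T.opNorm_comp_le _).trans ?_
    gcongr
    refine (G.subtypeL.opNorm_comp_le _).trans ?_
    exact mul_le_of_le_one_left (norm_nonneg _) G.norm_subtypeL_le
  calc 96 * ‖T ∘L G.subtypeL ∘L E₂‖ * (‖E₁‖ * c)
      ≤ 96 * (‖T‖ * ‖E₂‖) * (‖E₁‖ * c) := by gcongr
    _ = 96 * ‖T‖ * c * (‖E₁‖ * ‖E₂‖) := by ring
    _ ≤ 96 * ‖T‖ * c * σ := by gcongr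
    _ = _ := by ring

/-- Functionals on `X` restrict to `K` without increase of norm, so a weak bound in `K` is also one
in `X`. -/
theorem SummingBound.comp_subtypeL {𝕜 : Type*} [RCLike 𝕜] {X Y : Type*}
    [NormedAddCommGroup X] [NormedSpace 𝕜 X] [NormedAddCommGroup Y] [NormedSpace 𝕜 Y]
    {T : X →L[𝕜] Y} {C : ℝ} (hT : SummingBound T C) (K : Submodule 𝕜 X) :
    SummingBound (T ∘L K.subtypeL) C := by
  intro m x c hc
  refine hT m (fun i => x i) c fun φ hφ => hc (φ ∘L K.subtypeL) ?_
  refine (φ.opNorm_comp_le _).trans (mul_le_one₀ hφ (norm_nonneg _) K.norm_subtypeL_le)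

/-! ### Truncation and inclusion between `ℓ²` and `ℓ²ₙ` -/

/-- The operator on `ℓ²` which returns the first `n` coordinates. -/
noncomputable def ellTwoTruncate (𝕜 : Type*) [RCLike 𝕜] (n : ℕ) : EllTwo 𝕜 →L[𝕜] EuclideanSpace 𝕜 (Fin n) :=
  LinearMap.mkContinuous
    { toFun := fun x => WithLp.toLp 2 fun i => x i
      map_add' := fun x y => by ext; simp
      map_smul' := fun r x => by ext; simp } 1 (by
    intro x
    rw [one_mul, ← sq_le_sq₀ (norm_nonneg _) (norm_nonneg _), EuclideanSpace.norm_sq_eq]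
    have h := lp.sum_rpow_le_norm_rpow (p := 2) (by norm_num) x (Finset.range n)
    simp only [ENNReal.toReal_ofNat, Real.rpow_two] at h
    rwa [Finset.sum_range] at h)

theorem ellTwoTruncate_apply {𝕜 : Type*} [RCLike 𝕜] {n : ℕ} (x : EllTwo 𝕜) (i : Fin n) :
    ellTwoTruncate 𝕜 n x i = x i := rfl

theorem norm_ellTwoTruncate_le (𝕜 : Type*) [RCLike 𝕜] (n : ℕ) : ‖ellTwoTruncate 𝕜 n‖ ≤ 1 :=
  LinearMap.mkContinuous_norm_le _ zero_le_one _

theorem tendsto_norm_ellTwoTruncate {𝕜 : Type*} [RCLike 𝕜] (x : EllTwo 𝕜) :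
    Filter.Tendsto (fun n => ‖ellTwoTruncate 𝕜 n x‖) Filter.atTop (nhds ‖x‖) := by
  have h := (lp.hasSum_norm (p := 2) (by norm_num) x).tendsto_sum_nat
  simp only [ENNReal.toReal_ofNat, Real.rpow_two] at h
  have h2 := h.sqrt
  rw [Real.sqrt_sq (norm_nonneg _)] at h2
  refine h2.congr fun n => ?_
  rw [Finset.sum_range, EuclideanSpace.norm_eq]
  rfl

theorem norm_sum_single_ellTwo {𝕜 : Type*} [RCLike 𝕜] {n : ℕ} (x : EuclideanSpace 𝕜 (Fin n)) :
    ‖(∑ i : Fin n, lp.single 2 (i : ℕ) (x i) : EllTwo 𝕜)‖ = ‖x‖ := by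
  have h := lp.norm_sum_single (E := fun _ : ℕ => 𝕜) (p := 2) (by norm_num)
    (fun k => if hk : k < n then x ⟨k, hk⟩ else 0) (Finset.range n)
  simp only [ENNReal.toReal_ofNat, Real.rpow_two, Finset.sum_range, Fin.is_lt, dite_true,
    Fin.eta] at h
  rw [← sq_eq_sq₀ (norm_nonneg _) (norm_nonneg _), EuclideanSpace.norm_sq_eq, h]

/-- The isometric inclusion of `ℓ²ₙ` into `ℓ²`. -/
noncomputable def ellTwoInclusion (𝕜 : Type*) [RCLike 𝕜] (n : ℕ) :
    EuclideanSpace 𝕜 (Fin n) →L[𝕜] EllTwo 𝕜 :=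
  LinearMap.mkContinuous
    { toFun := fun x => ∑ i : Fin n, lp.single 2 (i : ℕ) (x i)
      map_add' := fun x y => by simp [lp.single_add, Finset.sum_add_distrib]
      map_smul' := fun r x => by
        simp only [PiLp.smul_apply, lp.single_smul, Finset.smul_sum, RingHom.id_apply] } 1
    (fun x => by rw [one_mul]; exact (norm_sum_single_ellTwo x).le)

theorem norm_ellTwoInclusion_le (𝕜 : Type*) [RCLike 𝕜] (n : ℕ) : ‖ellTwoInclusion 𝕜 n‖ ≤ 1 :=
  LinearMap.mkContinuous_norm_le _ zero_le_one _

theorem ellTwoTruncate_ellTwoInclusion {𝕜 : Type*} [RCLike 𝕜] {n : ℕ}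
    (x : EuclideanSpace 𝕜 (Fin n)) : ellTwoTruncate 𝕜 n (ellTwoInclusion 𝕜 n x) = x := by
  ext j
  rw [ellTwoTruncate_apply]
  change (∑ i : Fin n, lp.single 2 (i : ℕ) (x i) : EllTwo 𝕜) (j : ℕ) = x j
  rw [lp.coeFn_sum, Finset.sum_apply, Finset.sum_eq_single j]
  · simp
  · intro i _ hij
    exact lp.single_apply_ne _ _ _ fun h => hij (Fin.ext h.symm)
  · simp

/-- A bound on the summing constants of all coordinate truncations of an operator into `ℓ²` bounds
its summing constant. -/
theorem summingBound_of_truncate {𝕜 : Type*} [RCLike 𝕜] {X : Type*} [NormedAddCommGroup X]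
    [NormedSpace 𝕜 X] {T : X →L[𝕜] EllTwo 𝕜} {C : ℝ}
    (h : ∀ n, 0 < n → SummingBound (ellTwoTruncate 𝕜 n ∘L T) C) : SummingBound T C := by
  intro m x c hc
  refine le_of_tendsto (tendsto_finsetSum _ fun i _ => tendsto_norm_ellTwoTruncate (T (x i)))
    (Filter.eventually_atTop.2 ⟨1, fun n hn => h n hn m x c hc⟩)

/-! ### Pietsch domination and extension -/

/-- Operators defined on a subspace of a semi-inner product space extend to the whole space. -/
theorem exists_extension_of_bound {𝕜 V H : Type*} [RCLike 𝕜] [SeminormedAddCommGroup V]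
    [InnerProductSpace 𝕜 V] [NormedAddCommGroup H] [NormedSpace 𝕜 H] [CompleteSpace H]
    (K : Submodule 𝕜 V) (T : K →ₗ[𝕜] H) (C : ℝ) (hC : 0 ≤ C)
    (hT : ∀ k : K, ‖T k‖ ≤ C * ‖(k : V)‖) :
    ∃ T' : V →ₗ[𝕜] H, (∀ k : K, T' k = T k) ∧ ∀ x, ‖T' x‖ ≤ C * ‖x‖ := by
  let ι : V →ₗᵢ[𝕜] UniformSpace.Completion V := UniformSpace.Completion.toComplₗᵢ
  -- Pass to the closure of `K` in the completion, extend by density, and precompose with the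
  -- orthogonal projection.
  let M : Submodule 𝕜 (UniformSpace.Completion V) := (K.map ι.toLinearMap).topologicalClosure
  have hM : ∀ k : K, ι k ∈ M := fun k =>
    Submodule.le_topologicalClosure _ (Submodule.mem_map_of_mem k.2)
  have : CompleteSpace M :=
    (Submodule.isClosed_topologicalClosure _).completeSpace_coe
  let e : K →ₗ[𝕜] M := (ι.toLinearMap ∘ₗ K.subtype).codRestrict M hM
  have he : ∀ k, ‖e k‖ = ‖(k : V)‖ := fun k => ι.norm_map k
  have hd : DenseRange e := by
    rw [DenseRange, Subtype.dense_iff]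
    intro x hx
    have hx' : x ∈ closure ((K.map ι.toLinearMap : Submodule 𝕜 _) : Set _) := hx
    refine closure_mono ?_ hx'
    rintro _ ⟨k, hk, rfl⟩
    exact ⟨e ⟨k, hk⟩, ⟨⟨k, hk⟩, rfl⟩, rfl⟩
  have hT' : ∀ k, ‖T k‖ ≤ C * ‖e k‖ := fun k => by rw [he]; exact hT k
  refine ⟨(T.extendOfNorm e).toLinearMap ∘ₗ M.orthogonalProjectionOnto.toLinearMap ∘ₗ
    ι.toLinearMap, fun k => ?_, fun x => ?_⟩
  · have h1 : M.orthogonalProjectionOnto (ι k) = e k :=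
      Submodule.orthogonalProjectionOnto_mem_subspace_eq_self (e k)
    change T.extendOfNorm e (M.orthogonalProjectionOnto (ι k)) = _
    rw [h1, LinearMap.extendOfNorm_eq hd ⟨C, hT'⟩]
  · refine (LinearMap.norm_extendOfNorm_apply_le hd C hT' _).trans ?_
    gcongr
    exact (Submodule.norm_orthogonalProjectionOnto_apply_le M _).trans (ι.norm_map x).le

/-- The semi-inner product is an explicit argument because the space it will live on, `F`, already
carries its own norm. -/
theorem exists_extension_of_core {𝕜 V H : Type*} [RCLike 𝕜] [AddCommGroup V] [Module 𝕜 V]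
    [NormedAddCommGroup H] [NormedSpace 𝕜 H] [CompleteSpace H]
    (c : PreInnerProductSpace.Core 𝕜 V) (K : Submodule 𝕜 V) (T : K →ₗ[𝕜] H) (C : ℝ) (hC : 0 ≤ C)
    (hT : ∀ k : K, ‖T k‖ ^ 2 ≤ C ^ 2 * RCLike.re (c.inner k k)) :
    ∃ T' : V →ₗ[𝕜] H, (∀ k : K, T' k = T k) ∧
      ∀ x, ‖T' x‖ ^ 2 ≤ C ^ 2 * RCLike.re (c.inner x x) := by
  let _ : SeminormedAddCommGroup V := InnerProductSpace.Core.toSeminormedAddCommGroup (𝕜 := 𝕜)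
  let _ : InnerProductSpace 𝕜 V := InnerProductSpace.ofCore c
  have hn : ∀ x : V, ‖x‖ ^ 2 = RCLike.re (c.inner x x) := fun x => norm_sq_eq_re_inner (𝕜 := 𝕜) x
  simp only [← hn, ← mul_pow] at hT ⊢
  obtain ⟨T', h1, h2⟩ := exists_extension_of_bound K T C hC fun k =>
    (sq_le_sq₀ (norm_nonneg _) (mul_nonneg hC (norm_nonneg _))).1 (hT k)
  exact ⟨T', h1, fun x => by gcongr; exact h2 x⟩

open BoundedContinuousFunction in
/-- A cone of functions none of which is bounded above by a negative number admits a mean which is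
nonnegative on it. -/
theorem exists_mean_nonneg_on {S : Type*} [TopologicalSpace S] (D : Set (S →ᵇ ℝ))
    (hD0 : 0 ∈ D) (hDadd : ∀ d ∈ D, ∀ d' ∈ D, d + d' ∈ D)
    (hDsmul : ∀ r : ℝ, 0 ≤ r → ∀ d ∈ D, r • d ∈ D)
    (h : ∀ d ∈ D, ∀ ε > 0, ∃ s, -ε < d s) :
    ∃ Λ : (S →ᵇ ℝ) →L[ℝ] ℝ, (∀ f : S →ᵇ ℝ, (∀ s, 0 ≤ f s) → 0 ≤ Λ f) ∧
      Λ (const S 1) = 1 ∧ ∀ d ∈ D, 0 ≤ Λ d := by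
  -- The functions with negative supremum form an open convex set, disjoint from `D`; Hahn–Banach
  -- separates the two. No compactness of `S` is needed, since a mean suffices in place of a
  -- measure.
  let A : Set (S →ᵇ ℝ) := {f | ∃ ε > 0, ∀ s, f s ≤ -ε}
  have hAc : Convex ℝ A := by
    rintro f ⟨ε, hε, hf⟩ g ⟨δ, hδ, hg⟩ a b ha hb hab
    refine ⟨min ε δ, lt_min hε hδ, fun s => ?_⟩
    have h1 := mul_le_mul_of_nonneg_left ((hf s).trans (neg_le_neg (min_le_left ε δ))) ha
    have h2 := mul_le_mul_of_nonneg_left ((hg s).trans (neg_le_neg (min_le_right ε δ))) hb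
    simp only [coe_add, coe_smul, Pi.add_apply, smul_eq_mul]
    calc _ ≤ a * -min ε δ + b * -min ε δ := add_le_add h1 h2
      _ = (a + b) * -min ε δ := by ring
      _ = _ := by rw [hab, one_mul]
  have hAo : IsOpen A := by
    rw [Metric.isOpen_iff]
    rintro f ⟨ε, hε, hf⟩
    refine ⟨ε / 2, by positivity, fun g hg => ⟨ε / 2, by positivity, fun s => ?_⟩⟩
    have h1 := (dist_coe_le_dist (f := g) (g := f) s).trans_lt (Metric.mem_ball.1 hg)
    rw [Real.dist_eq, abs_lt] at h1
    linarith [hf s, h1.2]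
  have hDc : Convex ℝ D := fun f hf g hg a b ha hb _ =>
    hDadd _ (hDsmul a ha f hf) _ (hDsmul b hb g hg)
  have hdisj : Disjoint A D := by
    rw [Set.disjoint_left]
    rintro f ⟨ε, hε, hf⟩ hfD
    obtain ⟨s, hs⟩ := h f hfD ε hε
    linarith [hf s]
  obtain ⟨Λ, u, hA, hD⟩ := geometric_hahn_banach_open hAc hAo hDc hdisj
  have hu : u ≤ 0 := by simpa using hD 0 hD0
  have hDn : ∀ d ∈ D, 0 ≤ Λ d := by
    intro d hd
    by_contra hneg
    rw [not_le] at hneg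
    -- Scaled this way, `d` would have the value `u - 1`, below the separating level `u`.
    have h1 := hD _ (hDsmul ((1 - u) / -Λ d) (div_nonneg (by linarith) (by linarith)) d hd)
    rw [map_smul, smul_eq_mul, div_mul_eq_mul_div, div_neg, mul_div_assoc, div_self hneg.ne] at h1
    linarith
  have hneg : ∀ f : S →ᵇ ℝ, f ∈ A → Λ f < 0 := fun f hf => (hA f hf).trans_le hu
  have h1 : 0 < Λ (const S 1) := by
    have := hneg (-(const S 1)) ⟨1, one_pos, fun s => by simp⟩
    rw [map_neg] at this
    linarith
  have hpos : ∀ f : S →ᵇ ℝ, (∀ s, 0 ≤ f s) → 0 ≤ Λ f := by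
    intro f hf
    refine le_of_forall_pos_lt_add fun ε hε => ?_
    have := hneg (-(f + (ε / Λ (const S 1)) • const S 1))
      ⟨ε / Λ (const S 1), by positivity, fun s => by simpa using hf s⟩
    rw [map_neg, map_add, map_smul, smul_eq_mul, div_mul_cancel₀ _ h1.ne'] at this
    linarith
  refine ⟨(Λ (const S 1))⁻¹ • Λ, fun f hf => ?_, ?_, fun d hd => ?_⟩
  · exact mul_nonneg (inv_nonneg.2 h1.le) (hpos f hf)
  · exact inv_mul_cancel₀ h1.ne'
  · exact mul_nonneg (inv_nonneg.2 h1.le) (hDn d hd)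

/-- `1`-summing operators are `2`-summing. -/
theorem SummingBound.sum_sq_le {𝕜 : Type*} [RCLike 𝕜] {X Y : Type*} [NormedAddCommGroup X]
    [NormedSpace 𝕜 X] [NormedAddCommGroup Y] [NormedSpace 𝕜 Y] {T : X →L[𝕜] Y} {C : ℝ}
    (hC : 0 < C) (hT : SummingBound T C) {m : ℕ} (x : Fin m → X) (c : ℝ)
    (hc : ∀ φ : X →L[𝕜] 𝕜, ‖φ‖ ≤ 1 → C ^ 2 * ∑ i, ‖φ (x i)‖ ^ 2 ≤ c) :
    ∑ i, ‖T (x i)‖ ^ 2 ≤ c := by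
  set A := ∑ i, ‖T (x i)‖ ^ 2 with hA
  have hA0 : 0 ≤ A := by positivity
  have hc0 : 0 ≤ c := by simpa using hc 0 (by simp)
  -- Weighting each `x i` by `‖T (x i)‖` turns the strong sum into `A`, while Cauchy–Schwarz bounds
  -- the weak sums by `√(A * c) / C`. So `A ≤ √(A * c)`.
  have h := hT m (fun i => ((‖T (x i)‖ : ℝ) : 𝕜) • x i) (√(A * c) / C) fun φ hφ => by
    rw [le_div_iff₀ hC]
    refine Real.le_sqrt_of_sq_le ?_
    simp only [map_smul, norm_smul, RCLike.norm_ofReal, abs_norm]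
    calc _ = (∑ i, ‖T (x i)‖ * ‖φ (x i)‖) ^ 2 * C ^ 2 := by ring
      _ ≤ (A * ∑ i, ‖φ (x i)‖ ^ 2) * C ^ 2 := by
        gcongr
        exact Finset.sum_mul_sq_le_sq_mul_sq _ _ _
      _ = A * (C ^ 2 * ∑ i, ‖φ (x i)‖ ^ 2) := by ring
      _ ≤ A * c := by gcongr; exact hc φ hφ
  rw [mul_div_cancel₀ _ hC.ne'] at h
  have h' : A ≤ √(A * c) := by
    refine le_trans (le_of_eq ?_) h
    refine Finset.sum_congr rfl fun i _ => ?_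
    rw [map_smul, norm_smul, RCLike.norm_ofReal, abs_norm, sq]
  have h2 := (Real.le_sqrt hA0 (mul_nonneg hA0 hc0)).1 h'
  rcases hA0.eq_or_lt with h3 | h3
  · linarith
  · nlinarith

open BoundedContinuousFunction in
/-- **Pietsch domination** by a semi-inner product. -/
theorem SummingBound.exists_core {𝕜 : Type*} [RCLike 𝕜] {F Y : Type*} [NormedAddCommGroup F]
    [NormedSpace 𝕜 F] [NormedAddCommGroup Y] [NormedSpace 𝕜 Y] {K : Submodule 𝕜 F}
    {T : K →L[𝕜] Y} {C : ℝ} (hC : 0 < C) (hT : SummingBound T C) :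
    ∃ c : PreInnerProductSpace.Core 𝕜 F, (∀ x, RCLike.re (c.inner x x) ≤ ‖x‖ ^ 2) ∧
      ∀ k : K, ‖T k‖ ^ 2 ≤ C ^ 2 * RCLike.re (c.inner (k : F) (k : F)) := by
  let S := {φ : F →L[𝕜] 𝕜 // ‖φ‖ ≤ 1}
  have hS : ∀ (φ : S) x, ‖φ.1 x‖ ≤ ‖x‖ := fun φ x =>
    (φ.1.le_of_opNorm_le φ.2 x).trans_eq (one_mul _)
  have hcont : ∀ x : F, Continuous fun φ : S => φ.1 x := fun x =>
    (ContinuousLinearMap.apply 𝕜 𝕜 x).continuous.comp continuous_subtype_val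
  have hbd : ∀ (x y : F) (φ : S), ‖(starRingEnd 𝕜) (φ.1 x) * φ.1 y‖ ≤ ‖x‖ * ‖y‖ := by
    intro x y φ
    rw [norm_mul, RCLike.norm_conj]
    exact mul_le_mul (hS φ x) (hS φ y) (norm_nonneg _) (norm_nonneg _)
  let R : F → F → (S →ᵇ ℝ) := fun x y => BoundedContinuousFunction.ofNormedAddCommGroup
    (fun φ => RCLike.re ((starRingEnd 𝕜) (φ.1 x) * φ.1 y))
    (RCLike.continuous_re.comp ((RCLike.continuous_conj.comp (hcont x)).mul (hcont y)))
    (‖x‖ * ‖y‖) fun φ => (RCLike.norm_re_le_norm _).trans (hbd x y φ)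
  let J : F → F → (S →ᵇ ℝ) := fun x y => BoundedContinuousFunction.ofNormedAddCommGroup
    (fun φ => RCLike.im ((starRingEnd 𝕜) (φ.1 x) * φ.1 y))
    (RCLike.continuous_im.comp ((RCLike.continuous_conj.comp (hcont x)).mul (hcont y)))
    (‖x‖ * ‖y‖) fun φ => (RCLike.norm_im_le_norm _).trans (hbd x y φ)
  have hR : ∀ x y φ, R x y φ = RCLike.re ((starRingEnd 𝕜) (φ.1 x) * φ.1 y) := fun _ _ _ => rfl
  have hJ : ∀ x y φ, J x y φ = RCLike.im ((starRingEnd 𝕜) (φ.1 x) * φ.1 y) := fun _ _ _ => rfl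
  have hRR : ∀ x φ, R x x φ = ‖φ.1 x‖ ^ 2 := fun x φ => by
    rw [hR, RCLike.conj_mul, ← RCLike.ofReal_pow, RCLike.ofReal_re]
  -- A mean `Λ` nonnegative on every `d k` yields the domination, with `x, y ↦ Λ (conj (φ x) * φ y)`
  -- as semi-inner product. As `Λ` is real linear, `R` and `J` carry the real and imaginary parts.
  let d : K → (S →ᵇ ℝ) := fun k => C ^ 2 • R k k - ‖T k‖ ^ 2 • const S 1
  have hd : ∀ k φ, d k φ = C ^ 2 * ‖φ.1 k‖ ^ 2 - ‖T k‖ ^ 2 := fun k φ => by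
    simp [d, hRR]
  obtain ⟨Λ, hpos, hone, hΛ⟩ := exists_mean_nonneg_on
    {f | ∃ (m : ℕ) (x : Fin m → K), f = ∑ i, d (x i)} ⟨0, Fin.elim0, by simp⟩
    (by
      rintro _ ⟨m, x, rfl⟩ _ ⟨n, y, rfl⟩
      exact ⟨m + n, Fin.append x y, by simp [Fin.sum_univ_add]⟩)
    (by
      rintro r hr _ ⟨m, x, rfl⟩
      refine ⟨m, fun i => ((√r : ℝ) : 𝕜) • x i, ?_⟩
      rw [Finset.smul_sum]
      refine Finset.sum_congr rfl fun i _ => ?_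
      ext φ
      rw [coe_smul]
      beta_reduce
      rw [hd, hd, map_smul, Submodule.coe_smul, map_smul, norm_smul, norm_smul,
        RCLike.norm_ofReal, abs_of_nonneg (Real.sqrt_nonneg r), mul_pow, mul_pow, Real.sq_sqrt hr,
        smul_eq_mul]
      ring)
    (by
      rintro _ ⟨m, x, rfl⟩ ε hε
      by_contra hcon
      push Not at hcon
      have hcon' : ∀ φ : S, C ^ 2 * ∑ i, ‖φ.1 (x i)‖ ^ 2 ≤ ∑ i, ‖T (x i)‖ ^ 2 - ε := by
        intro φ
        have := hcon φ
        rw [BoundedContinuousFunction.coe_sum, Finset.sum_apply] at this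
        simp only [hd, Finset.sum_sub_distrib, ← Finset.mul_sum] at this
        linarith
      -- If a sum of the `d (x i)` were at most `-ε` everywhere, the `2`-summing estimate would be
      -- violated. Functionals on `K` are tested through Hahn–Banach extensions to `F`.
      have := hT.sum_sq_le hC x _ fun φ hφ => by
        obtain ⟨ψ, hψ, hψn⟩ := exists_extension_norm_eq K φ
        simp only [← hψ]
        exact hcon' ⟨ψ, hψn.trans_le hφ⟩
      linarith)
  have hre : ∀ a b : ℝ, RCLike.re ((a : 𝕜) + (b : 𝕜) * RCLike.I) = a := by simp
  refine ⟨{ inner := fun x y => (Λ (R x y) : 𝕜) + (Λ (J x y) : 𝕜) * RCLike.I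
            conj_inner_symm := fun x y => ?_
            re_inner_nonneg := fun x => ?_
            add_left := fun x y z => ?_
            smul_left := fun x y r => ?_ }, fun x => ?_, fun k => ?_⟩
  · have h1 : R y x = R x y := by
      ext φ
      simp only [hR, RCLike.mul_re, RCLike.conj_re, RCLike.conj_im]
      ring
    have h2 : J y x = -J x y := by
      ext φ
      simp only [hJ, BoundedContinuousFunction.coe_neg, Pi.neg_apply, RCLike.mul_im,
        RCLike.conj_re, RCLike.conj_im]
      ring
    simp [h1, h2]
  · have : 0 ≤ Λ (R x x) := hpos _ fun φ => by rw [hRR]; positivity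
    simpa using this
  · have h1 : R (x + y) z = R x z + R y z := by
      ext φ
      simp [hR, add_mul]
    have h2 : J (x + y) z = J x z + J y z := by
      ext φ
      simp [hJ, add_mul]
    simp only [h1, h2, map_add]
    ring
  · have h1 : R (r • x) y = RCLike.re r • R x y + RCLike.im r • J x y := by
      ext φ
      simp only [hR, hJ, BoundedContinuousFunction.coe_add, BoundedContinuousFunction.coe_smul,
        Pi.add_apply, map_smul, smul_eq_mul, map_mul, RCLike.mul_re, RCLike.mul_im, RCLike.conj_re,
        RCLike.conj_im]
      ring
    have h2 : J (r • x) y = RCLike.re r • J x y - RCLike.im r • R x y := by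
      ext φ
      simp only [hR, hJ, BoundedContinuousFunction.coe_sub, BoundedContinuousFunction.coe_smul,
        Pi.sub_apply, map_smul, smul_eq_mul, map_mul, RCLike.mul_re, RCLike.mul_im, RCLike.conj_re,
        RCLike.conj_im]
      ring
    have hI := @RCLike.I_mul_I 𝕜 _
    simp only [h1, h2, map_add, map_sub, map_smul, smul_eq_mul,
      RCLike.ofReal_mul]
    conv_rhs => rw [← RCLike.re_add_im ((starRingEnd 𝕜) r)]
    simp only [RCLike.conj_re, RCLike.conj_im, RCLike.ofReal_neg]
    rcases hI with hI | hI
    -- The real case, where `RCLike.I` is zero.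
    · have him : RCLike.im r = 0 := by
        have := RCLike.mul_im_I_ax r
        simpa [hI] using this.symm
      simp [him, hI]
    · linear_combination (RCLike.im r : 𝕜) * (Λ (J x y) : 𝕜) * hI
  · have h1 : Λ (R x x) ≤ ‖x‖ ^ 2 := by
      have := hpos (‖x‖ ^ 2 • const S 1 - R x x) fun φ => by
        have := hS φ x
        simp only [BoundedContinuousFunction.coe_sub, BoundedContinuousFunction.coe_smul,
          Pi.sub_apply, hRR, const_apply, smul_eq_mul, mul_one, sub_nonneg]
        gcongr
      rw [map_sub, map_smul, hone, smul_eq_mul, mul_one] at this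
      linarith
    exact (hre _ _).trans_le h1
  · have h1 := hΛ (d k) ⟨1, fun _ => k, by simp⟩
    rw [map_sub, map_smul, map_smul, hone, smul_eq_mul, smul_eq_mul, mul_one,
      sub_nonneg] at h1
    exact h1.trans_eq (congrArg _ (hre _ _).symm)

/-- **Pietsch extension**: a summing operator on a subspace, with values in a Banach space, extends
to the whole space. -/
theorem SummingBound.exists_extension {𝕜 : Type*} [RCLike 𝕜] {F Y : Type*} [NormedAddCommGroup F]
    [NormedSpace 𝕜 F] [NormedAddCommGroup Y] [NormedSpace 𝕜 Y] [CompleteSpace Y]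
    {K : Submodule 𝕜 F} {T : K →L[𝕜] Y} {C : ℝ} (hC : 0 ≤ C) (hT : SummingBound T C) :
    ∃ T' : F →L[𝕜] Y, T' ∘L K.subtypeL = T := by
  -- Domination requires a strictly positive constant.
  have hT' : SummingBound T (C + 1) := fun m x c hc => by
    have hc0 : 0 ≤ c := by simpa using hc 0 (by simp)
    linarith [hT m x c hc]
  obtain ⟨c, h1, h2⟩ := hT'.exists_core (by linarith)
  obtain ⟨T', h3, h4⟩ := exists_extension_of_core c K T.toLinearMap (C + 1) (by linarith) h2
  refine ⟨T'.mkContinuous (C + 1) fun x => ?_, ?_⟩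
  · rw [← sq_le_sq₀ (norm_nonneg _) (by positivity), mul_pow]
    exact (h4 x).trans (by gcongr; exact h1 x)
  · ext k
    exact h3 k

/-! ### Lifting operators from an `𝓛₁`-space -/

open Filter Topology in
/-- Bounded families in a Hilbert space have weak limits along ultrafilters. -/
theorem exists_weak_limit {𝕜 H ι : Type*} [RCLike 𝕜] [NormedAddCommGroup H]
    [InnerProductSpace 𝕜 H] [CompleteSpace H] (l : Ultrafilter ι) (f : ι → H) (c : ℝ)
    (hf : ∀ᶠ i in (l : Filter ι), ‖f i‖ ≤ c) :
    ∃ h : H, ‖h‖ ≤ c ∧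
      ∀ y, Tendsto (fun i => inner 𝕜 (f i) y) (l : Filter ι) (𝓝 (inner 𝕜 h y)) := by
  have hc : 0 ≤ c := by
    obtain ⟨i, hi⟩ := hf.exists
    exact (norm_nonneg _).trans hi
  have hex : ∀ y, ∃ L : 𝕜, ‖L‖ ≤ c * ‖y‖ ∧
      Tendsto (fun i => inner 𝕜 (f i) y) (l : Filter ι) (𝓝 L) := by
    intro y
    obtain ⟨L, hL, hL'⟩ := (isCompact_closedBall (0 : 𝕜) (c * ‖y‖)).ultrafilter_le_nhds
      (l.map fun i => inner 𝕜 (f i) y) (by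
        rw [Ultrafilter.coe_map, le_principal_iff, mem_map]
        filter_upwards [hf] with i hi
        rw [Set.mem_preimage, mem_closedBall_zero_iff]
        exact (norm_inner_le_norm _ _).trans (by gcongr))
    exact ⟨L, mem_closedBall_zero_iff.1 hL, hL'⟩
  choose L hL hlim using hex
  let Λ : H →ₗ[𝕜] 𝕜 :=
    { toFun := L
      map_add' := fun x y => tendsto_nhds_unique (hlim (x + y)) (by
        simpa only [inner_add_right] using (hlim x).add (hlim y))
      map_smul' := fun r x => tendsto_nhds_unique (hlim (r • x)) (by
        simpa only [inner_smul_right, RingHom.id_apply, smul_eq_mul] using (hlim x).const_mul r) }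
  refine ⟨(InnerProductSpace.toDual 𝕜 H).symm (Λ.mkContinuous c hL), ?_, fun y => ?_⟩
  · rw [LinearIsometryEquiv.norm_map]
    exact LinearMap.mkContinuous_norm_le _ hc _
  · rw [InnerProductSpace.toDual_symm_apply]
    exact hlim y

/-- Local liftings from an `𝓛₁`-space through a quotient map. -/
theorem IsScriptLOneSpace.exists_local_lift {𝕜 : Type*} [RCLike 𝕜] {F : Type*}
    [NormedAddCommGroup F] [NormedSpace 𝕜 F] (hF : IsScriptLOneSpace 𝕜 F) :
    ∃ C : ℝ, 0 ≤ C ∧ ∀ {Y E : Type*} [NormedAddCommGroup Y] [NormedSpace 𝕜 Y]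
      [NormedAddCommGroup E] [NormedSpace 𝕜 E] (q : Y →L[𝕜] E)
      (_ : ∀ e, ∃ y, q y = e ∧ ‖y‖ ≤ 2 * ‖e‖) (Q : F →L[𝕜] E) (A : Finset F),
      ∃ g : F →ₗ[𝕜] Y, ∀ x ∈ Submodule.span 𝕜 (A : Set F),
        q (g x) = Q x ∧ ‖g x‖ ≤ C * ‖Q‖ * ‖x‖ := by
  obtain ⟨σ, hσ, hF⟩ := hF
  refine ⟨2 * σ, by positivity, fun {Y E} _ _ _ _ q hq Q A => ?_⟩
  obtain ⟨G, hG, n, e, he⟩ := hF (Submodule.span 𝕜 (A : Set F))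
    (FiniteDimensional.span_finset 𝕜 A)
  set E₁ : G →L[𝕜] PiLp 1 (fun _ : Fin n => 𝕜) :=
    (e : G →L[𝕜] PiLp 1 (fun _ : Fin n => 𝕜)) with hE₁
  set E₂ : PiLp 1 (fun _ : Fin n => 𝕜) →L[𝕜] G :=
    (e.symm : PiLp 1 (fun _ : Fin n => 𝕜) →L[𝕜] G) with hE₂
  let b : Fin n → PiLp 1 (fun _ : Fin n => 𝕜) := fun j => WithLp.toLp 1 (Pi.single j 1)
  have hb : ∀ j, ‖b j‖ ≤ 1 := fun j => by simp [b]
  have hu : ∀ u : PiLp 1 (fun _ : Fin n => 𝕜), u = ∑ j, u j • b j := by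
    intro u
    ext k
    rw [WithLp.ofLp_sum, Finset.sum_apply]
    simp [b]
  -- On `ℓ¹ₙ` a lift is determined by arbitrary lifts of the unit vectors, and its norm is at most
  -- the largest of their norms. The extension from `G` to `F` is merely algebraic.
  choose y hy hyn using fun j => hq (Q (E₂ (b j)))
  let g₀ : G →ₗ[𝕜] Y := ∑ j, (LinearMap.proj j ∘ₗ
    (WithLp.linearEquiv 1 𝕜 (Fin n → 𝕜)).toLinearMap ∘ₗ E₁.toLinearMap).smulRight (y j)
  have hg₀ : ∀ x, g₀ x = ∑ j, E₁ x j • y j := fun x => by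
    simp [g₀, LinearMap.sum_apply]
  obtain ⟨g, hg⟩ := LinearMap.exists_extend g₀
  refine ⟨g, fun x hx => ?_⟩
  have hgx : g x = ∑ j, E₁ ⟨x, hG hx⟩ j • y j := by
    rw [← hg₀, ← hg]
    rfl
  rw [hgx]
  constructor
  · rw [map_sum]
    simp only [map_smul, hy]
    have h1 := congrArg (fun u => Q (E₂ u)) (hu (E₁ ⟨x, hG hx⟩))
    simp only [map_sum, map_smul, Submodule.coe_sum, Submodule.coe_smul] at h1
    rw [← h1]
    simp [E₁, E₂]
  · have hyn' : ∀ j, ‖y j‖ ≤ 2 * (‖Q‖ * ‖E₂‖) := fun j => by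
      refine (hyn j).trans ?_
      gcongr
      refine (Q.le_opNorm _).trans ?_
      gcongr
      exact (E₂.le_opNorm_of_le (hb j)).trans_eq (mul_one _)
    calc ‖∑ j, E₁ ⟨x, hG hx⟩ j • y j‖ ≤ ∑ j, ‖E₁ ⟨x, hG hx⟩ j‖ * (2 * (‖Q‖ * ‖E₂‖)) := by
          refine (norm_sum_le _ _).trans (Finset.sum_le_sum fun j _ => ?_)
          rw [norm_smul]
          gcongr
          exact hyn' j
      _ = ‖E₁ ⟨x, hG hx⟩‖ * (2 * (‖Q‖ * ‖E₂‖)) := by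
          rw [← Finset.sum_mul, PiLp.norm_eq_of_L1]
      _ ≤ (‖E₁‖ * ‖x‖) * (2 * (‖Q‖ * ‖E₂‖)) := by
          gcongr
          exact E₁.le_opNorm _
      _ = 2 * (‖E₁‖ * ‖E₂‖) * ‖Q‖ * ‖x‖ := by ring
      _ ≤ 2 * σ * ‖Q‖ * ‖x‖ := by gcongr

open Filter Topology in
/-- **Lindenstrauss lifting**: operators from an `𝓛₁`-space lift through quotient maps whose kernel
is a Hilbert space. -/
theorem IsScriptLOneSpace.exists_lift {𝕜 : Type*} [RCLike 𝕜] {F : Type*}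
    [NormedAddCommGroup F] [NormedSpace 𝕜 F] (hF : IsScriptLOneSpace 𝕜 F) :
    ∃ C : ℝ, 0 ≤ C ∧ ∀ {H Y E : Type*} [NormedAddCommGroup H] [InnerProductSpace 𝕜 H]
      [CompleteSpace H] [NormedAddCommGroup Y] [NormedSpace 𝕜 Y]
      [NormedAddCommGroup E] [NormedSpace 𝕜 E] (j : H →ₗᵢ[𝕜] Y) (q : Y →L[𝕜] E)
      (_ : LinearMap.range j.toLinearMap = LinearMap.ker q.toLinearMap)
      (_ : ∀ e, ∃ y, q y = e ∧ ‖y‖ ≤ 2 * ‖e‖) (Q : F →L[𝕜] E),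
      ∃ G : F →L[𝕜] Y, q ∘L G = Q ∧ ‖G‖ ≤ C * ‖Q‖ := by
  obtain ⟨C, hC, hloc⟩ := hF.exists_local_lift
  refine ⟨C + 4, by positivity, fun {H Y E} _ _ _ _ _ _ _ j q hjq hq Q => ?_⟩
  have hker : ∀ y, q y = 0 → ∃ h, j h = y := fun y hy => by
    have : y ∈ LinearMap.range j.toLinearMap := by rw [hjq]; exact hy
    exact this
  have hqj : ∀ h, q (j h) = 0 := fun h => by
    have : j h ∈ LinearMap.ker q.toLinearMap := by rw [← hjq]; exact ⟨h, rfl⟩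
    exact this
  choose s₀ hs₀ hs₀n using hq
  -- A homogeneously bounded but possibly nonlinear lift. The local linear lifts differ from it by
  -- bounded elements of `H`, whose weak limit `R` corrects `s` to a linear map.
  let s : F → Y := fun x => s₀ (Q x)
  have hs : ∀ x, q (s x) = Q x := fun x => hs₀ _
  have hsn : ∀ x, ‖s x‖ ≤ 2 * ‖Q‖ * ‖x‖ := fun x => by
    refine (hs₀n _).trans ?_
    rw [mul_assoc]
    gcongr
    exact Q.le_opNorm x
  choose g hg using hloc q (fun e => ⟨s₀ e, hs₀ e, hs₀n e⟩) Q
  have hr : ∀ (A : Finset F) (x : F), ∃ h : H, x ∈ Submodule.span 𝕜 (A : Set F) →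
      j h = g A x - s x := by
    intro A x
    by_cases hx : x ∈ Submodule.span 𝕜 (A : Set F)
    · obtain ⟨h, hh⟩ := hker (g A x - s x) (by rw [map_sub, (hg A x hx).1, hs, sub_self])
      exact ⟨h, fun _ => hh⟩
    · exact ⟨0, fun h => absurd h hx⟩
  choose r hr using hr
  have hrn : ∀ (A : Finset F) (x : F), x ∈ Submodule.span 𝕜 (A : Set F) → ‖r A x‖ ≤ (C + 2) * ‖Q‖ * ‖x‖ := by
    intro A x hx
    rw [← j.norm_map, hr A x hx]
    refine (norm_sub_le _ _).trans ?_
    linarith [(hg A x hx).2, hsn x]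
  let l : Ultrafilter (Finset F) := Ultrafilter.of atTop
  have hev : ∀ x : F, ∀ᶠ A : Finset F in (l : Filter (Finset F)), x ∈ Submodule.span 𝕜 (A : Set F) := by
    intro x
    refine Ultrafilter.of_le _ ((eventually_ge_atTop {x}).mono fun A hA => ?_)
    exact Submodule.subset_span (hA (Finset.mem_singleton_self x))
  choose R hRn hR using fun x => exists_weak_limit (𝕜 := 𝕜) l (fun A => r A x)
    ((C + 2) * ‖Q‖ * ‖x‖) ((hev x).mono fun A => hrn A x)
  let G₀ : F →ₗ[𝕜] Y :=
    { toFun := fun x => s x + j (R x)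
      map_add' := by
        intro x y
        -- The additivity defect of `s` is a fixed `w` in `H`. The linear lifts force `r A (x + y) =
        -- r A x + r A y + w` once the span of `A` contains `x` and `y`, and this survives in the
        -- limit.
        obtain ⟨w, hw⟩ := hker (s x + s y - s (x + y)) (by simp [hs])
        have : R (x + y) = R x + R y + w := by
          refine ext_inner_right 𝕜 fun u => tendsto_nhds_unique (hR (x + y) u) ?_
          rw [inner_add_left, inner_add_left]
          refine (((hR x u).add (hR y u)).add_const (inner 𝕜 w u)).congr' ?_
          filter_upwards [hev x, hev y] with A hx hy
          rw [← inner_add_left, ← inner_add_left]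
          congr 1
          apply j.injective
          rw [map_add, map_add, hw, hr A x hx, hr A y hy, hr A _ (add_mem hx hy), map_add]
          abel
        rw [this, map_add, map_add, hw]
        abel
      map_smul' := by
        intro a x
        obtain ⟨w, hw⟩ := hker (a • s x - s (a • x)) (by simp [hs])
        have : R (a • x) = a • R x + w := by
          refine ext_inner_right 𝕜 fun u => tendsto_nhds_unique (hR (a • x) u) ?_
          rw [inner_add_left, inner_smul_left]
          refine (((hR x u).const_mul ((starRingEnd 𝕜) a)).add_const (inner 𝕜 w u)).congr' ?_
          filter_upwards [hev x] with A hx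
          rw [← inner_smul_left, ← inner_add_left]
          congr 1
          apply j.injective
          rw [map_add, map_smul, hw, hr A x hx, hr A _ (Submodule.smul_mem _ a hx), map_smul,
            smul_sub]
          abel
        rw [this, map_add, map_smul, hw, RingHom.id_apply, smul_add]
        abel }
  have hG₀ : ∀ x, ‖G₀ x‖ ≤ (C + 4) * ‖Q‖ * ‖x‖ := fun x => by
    refine (norm_add_le _ _).trans ?_
    rw [j.norm_map]
    linarith [hsn x, hRn x]
  refine ⟨G₀.mkContinuous _ hG₀, ?_, LinearMap.mkContinuous_norm_le _ (by positivity) _⟩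
  ext x
  change q (s x + j (R x)) = Q x
  rw [map_add, hs, hqj, add_zero]

/-! ### Push-outs as twisted sums -/

/-- The vector space `V` with the norm of `W` transported along a linear equivalence. -/
def TransportedSpace {𝕜 V W : Type*} [Semiring 𝕜] [AddCommGroup V] [Module 𝕜 V] [AddCommGroup W]
    [Module 𝕜 W] (_f : V ≃ₗ[𝕜] W) : Type _ := V

namespace TransportedSpace

variable {𝕜 V W : Type*} [RCLike 𝕜] [AddCommGroup V] [Module 𝕜 V] [NormedAddCommGroup W]
  [NormedSpace 𝕜 W] (f : V ≃ₗ[𝕜] W)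

instance : AddCommGroup (TransportedSpace f) := inferInstanceAs (AddCommGroup V)

instance : Module 𝕜 (TransportedSpace f) := inferInstanceAs (Module 𝕜 V)

/-- The defining equivalence of a transported space. -/
def linearEquiv : TransportedSpace f ≃ₗ[𝕜] W := f

noncomputable instance : NormedAddCommGroup (TransportedSpace f) :=
  NormedAddCommGroup.induced _ W (linearEquiv f) (linearEquiv f).injective

noncomputable instance : NormedSpace 𝕜 (TransportedSpace f) :=
  NormedSpace.induced 𝕜 _ W (linearEquiv f)

/-- A transported space is isometric to the original space. -/
noncomputable def isometryEquiv : TransportedSpace f ≃ₗᵢ[𝕜] W :=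
  ⟨linearEquiv f, fun _ => rfl⟩

instance [CompleteSpace W] : CompleteSpace (TransportedSpace f) :=
  (isometryEquiv f).toIsometryEquiv.completeSpace_iff.2 inferInstance

end TransportedSpace

/-- A short exact sequence with arbitrary middle space is isometric to a `TwistedSum`. -/
theorem TwistedSum.exists_of_exact {𝕜 : Type w} [RCLike 𝕜] {H : Type u} {E : Type v}
    [NormedAddCommGroup H] [NormedSpace 𝕜 H] [NormedAddCommGroup E] [NormedSpace 𝕜 E]
    {W : Type*} [NormedAddCommGroup W] [NormedSpace 𝕜 W] [CompleteSpace W]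
    (j : H →ₗᵢ[𝕜] W) (q : W →L[𝕜] E)
    (hjq : LinearMap.range j.toLinearMap = LinearMap.ker q.toLinearMap)
    (hq : q '' Metric.ball 0 1 = Metric.ball 0 1) :
    ∃ (Y : TwistedSum 𝕜 H E) (Φ : W →ₗᵢ[𝕜] Y.space), (∀ h, Y.j h = Φ (j h)) ∧
      ∀ x, Y.q (Φ x) = q x := by
  have hqj : ∀ h, q (j h) = 0 := fun h => by
    have : j h ∈ LinearMap.ker q.toLinearMap := by rw [← hjq]; exact ⟨h, rfl⟩
    exact this
  have hker : ∀ y, q y = 0 → ∃ h, j h = y := fun y hy => by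
    have : y ∈ LinearMap.range j.toLinearMap := by rw [hjq]; exact hy
    exact this
  have hsurj : LinearMap.range q.toLinearMap = ⊤ := by
    rw [LinearMap.range_eq_top]
    intro e
    obtain ⟨r, hr, hre⟩ : ∃ r : 𝕜, r ≠ 0 ∧ ‖r • e‖ < 1 := by
      refine ⟨(((‖e‖ + 1 : ℝ)⁻¹ : ℝ) : 𝕜), ?_, ?_⟩
      · have : (‖e‖ + 1 : ℝ)⁻¹ ≠ 0 := by positivity
        exact_mod_cast this
      · rw [norm_smul, RCLike.norm_ofReal, abs_of_nonneg (by positivity),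
          inv_mul_lt_iff₀ (by positivity)]
        linarith
    have : r • e ∈ q '' Metric.ball 0 1 := by rw [hq]; simpa using hre
    obtain ⟨y, -, hy⟩ := this
    refine ⟨r⁻¹ • y, ?_⟩
    change q (r⁻¹ • y) = e
    rw [map_smul, hy, smul_smul, inv_mul_cancel₀ hr, one_smul]
  obtain ⟨t, ht⟩ := q.toLinearMap.exists_rightInverse_of_surjective hsurj
  have ht' : ∀ e, q (t e) = e := fun e => LinearMap.congr_fun ht e
  -- A linear right inverse `t`, not necessarily bounded, identifies `W` with `H × E` algebraically;
  -- transporting the norm puts the middle space in the required universe.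
  let f : (H × E) ≃ₗ[𝕜] W := LinearEquiv.ofBijective (j.toLinearMap.coprod t) (by
    constructor
    · rw [← LinearMap.ker_eq_bot, LinearMap.ker_eq_bot']
      rintro ⟨h, e⟩ he
      have he' : j h + t e = 0 := he
      have h1 : e = 0 := by
        have := congrArg q he'
        rwa [map_add, hqj, ht', zero_add, map_zero] at this
      subst h1
      rw [map_zero, add_zero] at he'
      have h2 : h = 0 := j.injective (he'.trans (map_zero j).symm)
      rw [h2]
      rfl
    · intro y
      obtain ⟨h, hh⟩ := hker (y - t (q y)) (by rw [map_sub, ht', sub_self])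
      refine ⟨(h, q y), ?_⟩
      change j h + t (q y) = y
      rw [hh, sub_add_cancel])
  let Φ := (TransportedSpace.isometryEquiv f).symm
  refine ⟨{ space := TransportedSpace f
            j := Φ.toLinearIsometry.comp j
            q := q ∘L (Φ.symm : TransportedSpace f →L[𝕜] W)
            range_j := ?_
            quotient_q := ?_ }, Φ.toLinearIsometry, fun h => rfl, fun x => ?_⟩
  · ext y
    constructor
    · rintro ⟨h, rfl⟩
      change q (Φ.symm (Φ (j h))) = 0
      rw [Φ.symm_apply_apply, hqj]
    · intro hy
      obtain ⟨h, hh⟩ := hker (Φ.symm y) hy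
      refine ⟨h, ?_⟩
      change Φ (j h) = y
      rw [hh, Φ.apply_symm_apply]
  · rw [← hq]
    ext e
    constructor
    · rintro ⟨y, hy, rfl⟩
      exact ⟨Φ.symm y, by simpa using hy, rfl⟩
    · rintro ⟨y, hy, rfl⟩
      exact ⟨Φ y, by simpa using hy, congrArg q (Φ.symm_apply_apply y)⟩
  · exact congrArg q (Φ.symm_apply_apply x)

/-- The algebraic push-out of `0 → ker Q → F → E` along an operator on `ker Q`, normed as a quotient
of an `ℓ¹`-sum. -/
theorem exists_pushout_space {𝕜 : Type*} [RCLike 𝕜] {F : Type t} {E : Type*} {H : Type u}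
    [NormedAddCommGroup F] [NormedSpace 𝕜 F] [CompleteSpace F] [NormedAddCommGroup E]
    [NormedSpace 𝕜 E] [NormedAddCommGroup H] [NormedSpace 𝕜 H] [CompleteSpace H] (Q : F →L[𝕜] E)
    (T : LinearMap.ker Q.toLinearMap →L[𝕜] H) (hT : ‖T‖ ≤ 1) :
    ∃ (P : Type (max u t)) (_ : NormedAddCommGroup P) (_ : NormedSpace 𝕜 P) (_ : CompleteSpace P)
      (i : H →ₗᵢ[𝕜] P) (g : F →L[𝕜] P) (p : P →L[𝕜] E), (∀ f, ‖g f‖ ≤ ‖f‖) ∧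
      (∀ k : LinearMap.ker Q.toLinearMap, g k = i (T k)) ∧ (∀ f, p (g f) = Q f) ∧
      (∀ h, p (i h) = 0) ∧ ∀ y, p y = 0 → ∃ h, i h = y := by
  let K := LinearMap.ker Q.toLinearMap
  have : CompleteSpace K := Q.isClosed_ker.completeSpace_coe
  let ι : K →ₗ[𝕜] WithLp 1 (H × F) := (WithLp.linearEquiv 1 𝕜 (H × F)).symm.toLinearMap ∘ₗ
    T.toLinearMap.prod (-K.subtype)
  have hι : ∀ k, ι k = WithLp.toLp 1 (T k, -(k : F)) := fun k => rfl
  have hn : ∀ (h : H) (f : F), ‖WithLp.toLp 1 (h, f)‖ = ‖h‖ + ‖f‖ := fun h f =>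
    WithLp.prod_norm_eq_of_L1 _
  let N : Submodule 𝕜 (WithLp 1 (H × F)) := LinearMap.range ι
  have hN : IsClosed (N : Set (WithLp 1 (H × F))) := by
    have hιn : ∀ k, ‖ι k‖ ≤ 2 * ‖k‖ := fun k => by
      have := T.le_of_opNorm_le hT k
      rw [hι, hn, norm_neg, ← Submodule.coe_norm]
      linarith
    have ha : AntilipschitzWith 1 ι := by
      refine AddMonoidHomClass.antilipschitz_of_bound ι fun k => ?_
      rw [hι, hn, norm_neg, NNReal.coe_one, one_mul, ← Submodule.coe_norm]
      exact le_add_of_nonneg_left (norm_nonneg _)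
    have := ha.isClosed_range (ι.mkContinuous 2 hιn).uniformContinuous
    rw [LinearMap.coe_range]
    exact this
  let π : WithLp 1 (H × F) →ₗ[𝕜] (WithLp 1 (H × F)) ⧸ N := N.mkQ
  have hπn : ∀ x, ‖π x‖ ≤ ‖x‖ := fun x => Submodule.Quotient.norm_mk_le N x
  have hπK : ∀ (k : K), π (WithLp.toLp 1 (T k, 0)) = π (WithLp.toLp 1 (0, (k : F))) := by
    intro k
    rw [← sub_eq_zero, ← map_sub]
    refine (Submodule.Quotient.mk_eq_zero N).2 ⟨k, ?_⟩
    rw [hι, ← WithLp.toLp_sub]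
    simp
  have hπH : ∀ h, ‖π (WithLp.toLp 1 (h, 0))‖ = ‖h‖ := by
    intro h
    -- The lower bound uses `‖T‖ ≤ 1`: `‖h + T k‖ + ‖k‖ ≥ ‖h + T k‖ + ‖T k‖ ≥ ‖h‖`.
    refine le_antisymm ((hπn _).trans_eq (by rw [hn, norm_zero]; simp)) ?_
    refine QuotientAddGroup.le_norm_iff.2 fun x hx => ?_
    have hx' : x - WithLp.toLp 1 (h, 0) ∈ N := by
      rw [← Submodule.Quotient.mk_eq_zero, Submodule.Quotient.mk_sub, sub_eq_zero]
      exact hx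
    obtain ⟨k, hk⟩ := hx'
    have hx'' : x = WithLp.toLp 1 (h + T k, -(k : F)) := by
      rw [← sub_add_cancel x (WithLp.toLp 1 (h, 0)), ← hk, hι, ← WithLp.toLp_add]
      simp [add_comm]
    rw [hx'', hn, norm_neg]
    have h1 := T.le_of_opNorm_le hT k
    have h2 := norm_sub_le (h + T k) (T k)
    rw [add_sub_cancel_right] at h2
    rw [one_mul, Submodule.coe_norm] at h1
    linarith
  let q₁ : WithLp 1 (H × F) →L[𝕜] E := LinearMap.mkContinuous
    (Q.toLinearMap ∘ₗ LinearMap.snd 𝕜 H F ∘ₗ (WithLp.linearEquiv 1 𝕜 (H × F)).toLinearMap) ‖Q‖ (by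
      intro x
      refine (Q.le_opNorm _).trans ?_
      gcongr
      rw [WithLp.prod_norm_eq_of_L1]
      exact le_add_of_nonneg_left (norm_nonneg _))
  have hq₁ : ∀ h f, q₁ (WithLp.toLp 1 (h, f)) = Q f := fun h f => rfl
  let q₀ : (WithLp 1 (H × F)) ⧸ N →L[𝕜] E := N.liftQL q₁ (by
    rintro _ ⟨k, rfl⟩
    change q₁ (ι k) = 0
    rw [hι, hq₁, map_neg, neg_eq_zero]
    exact k.2)
  have hq₀ : ∀ h f, q₀ (π (WithLp.toLp 1 (h, f))) = Q f := fun h f => rfl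
  let i : H →ₗᵢ[𝕜] (WithLp 1 (H × F)) ⧸ N :=
    ⟨π ∘ₗ (WithLp.linearEquiv 1 𝕜 (H × F)).symm.toLinearMap ∘ₗ LinearMap.inl 𝕜 H F, hπH⟩
  have hg : ∀ f, ‖π (WithLp.toLp 1 ((0 : H), f))‖ ≤ 1 * ‖f‖ := fun f =>
    (hπn _).trans_eq (by rw [hn, norm_zero]; simp)
  let g : F →L[𝕜] (WithLp 1 (H × F)) ⧸ N := LinearMap.mkContinuous
    (π ∘ₗ (WithLp.linearEquiv 1 𝕜 (H × F)).symm.toLinearMap ∘ₗ LinearMap.inr 𝕜 H F) 1 hg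
  refine ⟨(WithLp 1 (H × F)) ⧸ N, inferInstance, inferInstance, inferInstance, i, g, q₀,
    fun f => (hg f).trans_eq (one_mul _), fun k => (hπK k).symm, fun f => rfl, fun h => ?_,
    fun y hy => ?_⟩
  · exact map_zero Q
  · obtain ⟨⟨⟨h, f⟩⟩, rfl⟩ := N.mkQ_surjective y
    have hf : Q f = 0 := hy
    refine ⟨h + T ⟨f, hf⟩, ?_⟩
    change π (WithLp.toLp 1 (h + T ⟨f, hf⟩, 0)) = π (WithLp.toLp 1 (h, f))
    rw [show WithLp.toLp 1 (h + T ⟨f, hf⟩, (0 : F)) =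
      WithLp.toLp 1 (h, 0) + WithLp.toLp 1 (T ⟨f, hf⟩, 0) by rw [← WithLp.toLp_add]; simp,
      map_add, hπK, ← map_add, ← WithLp.toLp_add]
    simp

/-- The push-out of the extension `0 → ker Q → F → E → 0` along an operator on `ker Q`. -/
theorem TwistedSum.exists_pushout {𝕜 : Type w} [RCLike 𝕜] {F : Type*} {E : Type v}
    [NormedAddCommGroup F] [NormedSpace 𝕜 F] [CompleteSpace F] [NormedAddCommGroup E]
    [NormedSpace 𝕜 E] [CompleteSpace E] (Q : F →L[𝕜] E) (hQ : Function.Surjective Q) :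
    ∃ c : ℝ, 0 < c ∧ ∀ {H : Type u} [NormedAddCommGroup H] [NormedSpace 𝕜 H] [CompleteSpace H]
      (T : LinearMap.ker Q.toLinearMap →L[𝕜] H), ‖T‖ ≤ 1 →
      ∃ (Y : TwistedSum 𝕜 H E) (G : F →L[𝕜] Y.space), ‖G‖ ≤ c + ‖Q‖ ∧ (∀ x, Y.q (G x) = Q x) ∧
        ∀ k : LinearMap.ker Q.toLinearMap, G k = Y.j ((c : 𝕜) • T k) := by
  obtain ⟨M, hM, hpre⟩ := Q.exists_preimage_norm_le hQ
  refine ⟨M⁻¹, inv_pos.2 hM, fun {H} _ _ _ T hT => ?_⟩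
  set c : ℝ := M⁻¹ with hc
  have hc0 : 0 < c := inv_pos.2 hM
  have hcn : ‖(c : 𝕜)‖ = c := by rw [RCLike.norm_ofReal, abs_of_pos hc0]
  obtain ⟨P, _, _, _, i, g₀, p, hg₀, hgT, hpg, hpi, hex⟩ := exists_pushout_space Q T hT
  -- The map `p` need not be a metric quotient. On the graph `p y = c • e` with the maximum norm,
  -- the second projection has norm at most one, and `c = M⁻¹` makes `(c • g₀ f, Q f)` no longer
  -- than `Q f` for suitable `f`. The price is the factor `c` in front of `T`.
  let D : P × E →L[𝕜] E :=
    p ∘L ContinuousLinearMap.fst 𝕜 P E - (c : 𝕜) • ContinuousLinearMap.snd 𝕜 P E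
  let W : Submodule 𝕜 (P × E) := LinearMap.ker D.toLinearMap
  have hW : ∀ y e, (y, e) ∈ W ↔ p y = (c : 𝕜) • e := fun y e => sub_eq_zero
  have : CompleteSpace W := D.isClosed_ker.completeSpace_coe
  let j : H →ₗᵢ[𝕜] W :=
    ⟨LinearMap.codRestrict W (i.toLinearMap.prod 0) (fun h => (hW _ _).2 (by
      change p (i h) = (c : 𝕜) • (0 : E)
      rw [hpi, smul_zero])), fun h => by
      change ‖((i h, 0) : P × E)‖ = ‖h‖
      rw [Prod.norm_def, norm_zero, i.norm_map, max_eq_left (norm_nonneg _)]⟩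
  have hj : ∀ h, (j h : P × E) = (i h, 0) := fun h => rfl
  let q : W →L[𝕜] E := ContinuousLinearMap.snd 𝕜 P E ∘L W.subtypeL
  let g : F →L[𝕜] W := LinearMap.mkContinuous
    (LinearMap.codRestrict W (((c : 𝕜) • g₀.toLinearMap).prod Q.toLinearMap) (fun f =>
      (hW _ _).2 (by
        change p ((c : 𝕜) • g₀ f) = (c : 𝕜) • Q f
        rw [map_smul, hpg]))) (c + ‖Q‖) (fun f => by
      change ‖(((c : 𝕜) • g₀ f, Q f) : P × E)‖ ≤ _
      rw [Prod.norm_def, norm_smul, hcn, add_mul]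
      refine max_le ?_ ?_
      · refine le_add_of_le_of_nonneg ?_ (by positivity)
        gcongr
        exact hg₀ f
      · exact le_add_of_nonneg_of_le (by positivity) (Q.le_opNorm f))
  have hg : ∀ f, (g f : P × E) = ((c : 𝕜) • g₀ f, Q f) := fun f => rfl
  have hjq : LinearMap.range j.toLinearMap = LinearMap.ker q.toLinearMap := by
    ext ⟨⟨y, e⟩, hye⟩
    constructor
    · rintro ⟨h, hh⟩
      exact (congrArg (fun x : W => (x : P × E).2) hh).symm
    · intro he
      have he : e = 0 := he
      subst he
      obtain ⟨h, rfl⟩ := hex y (by rw [(hW _ _).1 hye, smul_zero])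
      exact ⟨h, rfl⟩
  have hball : q '' Metric.ball 0 1 = Metric.ball 0 1 := by
    ext e
    rw [mem_ball_zero_iff]
    constructor
    · rintro ⟨y, hy, rfl⟩
      rw [mem_ball_zero_iff] at hy
      exact (norm_snd_le (y : P × E)).trans_lt hy
    · intro he
      obtain ⟨f, rfl, hf⟩ := hpre e
      refine ⟨g f, ?_, rfl⟩
      rw [mem_ball_zero_iff, Submodule.coe_norm, hg, Prod.norm_def, norm_smul, hcn]
      refine max_lt (lt_of_le_of_lt ?_ he) he
      rw [hc, inv_mul_le_iff₀ hM]
      exact (hg₀ f).trans hf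
  obtain ⟨Y, Φ, hΦj, hΦq⟩ := TwistedSum.exists_of_exact j q hjq hball
  refine ⟨Y, Φ.toContinuousLinearMap ∘L g, ?_, fun x => hΦq _, fun k => ?_⟩
  · refine (ContinuousLinearMap.opNorm_comp_le _ _).trans ?_
    refine (mul_le_of_le_one_left (norm_nonneg _) Φ.norm_toContinuousLinearMap_le).trans ?_
    exact LinearMap.mkContinuous_norm_le _ (by positivity) _
  · change Φ (g k) = _
    rw [hΦj]
    congr 1
    apply Subtype.ext
    have hk : Q k = 0 := k.2
    rw [hg, hj, hgT, hk, map_smul]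

/-! ### Right inverses versus extensions -/

namespace TwistedSum

section Basic

variable {𝕜 : Type w} [RCLike 𝕜] {X : Type u} {Z : Type v} [NormedAddCommGroup X]
  [NormedSpace 𝕜 X] [NormedAddCommGroup Z] [NormedSpace 𝕜 Z] (Y : TwistedSum 𝕜 X Z)

theorem exists_preimage (e : Z) : ∃ y, Y.q y = e ∧ ‖y‖ ≤ 2 * ‖e‖ := by
  rcases eq_or_ne e 0 with rfl | he
  · exact ⟨0, by simp⟩
  have hpos : 0 < ‖e‖ := norm_pos_iff.2 he
  have hr : ((2 * ‖e‖ : ℝ) : 𝕜) ≠ 0 := by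
    have : 2 * ‖e‖ ≠ 0 := by positivity
    exact_mod_cast this
  have hrn : ‖((2 * ‖e‖ : ℝ) : 𝕜)‖ = 2 * ‖e‖ := by
    rw [RCLike.norm_ofReal, abs_of_nonneg (by positivity)]
  have hmem : (((2 * ‖e‖ : ℝ) : 𝕜)⁻¹ • e) ∈ Y.q '' Metric.ball 0 1 := by
    rw [Y.quotient_q, mem_ball_zero_iff, norm_smul, norm_inv, hrn, inv_mul_lt_iff₀ (by positivity)]
    linarith
  obtain ⟨y, hy, hye⟩ := hmem
  rw [mem_ball_zero_iff] at hy
  refine ⟨((2 * ‖e‖ : ℝ) : 𝕜) • y, ?_, ?_⟩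
  · rw [map_smul, hye, smul_smul, mul_inv_cancel₀ hr, one_smul]
  · rw [norm_smul, hrn]
    exact mul_le_of_le_one_right (by positivity) hy.le

theorem norm_q_le : ‖Y.q‖ ≤ 1 := by
  refine Y.q.opNorm_le_bound zero_le_one fun y => ?_
  rw [one_mul]
  refine le_of_forall_gt_imp_ge_of_dense fun r hr => ?_
  have hr0 : 0 < r := (norm_nonneg y).trans_lt hr
  have hrn : ‖((r : ℝ) : 𝕜)‖ = r := by rw [RCLike.norm_ofReal, abs_of_pos hr0]
  have hmem : Y.q ((r : 𝕜)⁻¹ • y) ∈ Metric.ball (0 : Z) 1 := by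
    rw [← Y.quotient_q]
    refine ⟨_, ?_, rfl⟩
    rwa [mem_ball_zero_iff, norm_smul, norm_inv, hrn, inv_mul_lt_iff₀ hr0, mul_one]
  rw [mem_ball_zero_iff, map_smul, norm_smul, norm_inv, hrn, inv_mul_lt_iff₀ hr0, mul_one] at hmem
  exact hmem.le

theorem q_j (x : X) : Y.q (Y.j x) = 0 := by
  have : Y.j x ∈ LinearMap.ker Y.q.toLinearMap := by rw [← Y.range_j]; exact ⟨x, rfl⟩
  exact this

/-- Operators into the kernel of the quotient map factor through the isometric embedding. -/
theorem exists_factor {V : Type*} [NormedAddCommGroup V] [NormedSpace 𝕜 V] (p : V →L[𝕜] Y.space)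
    (hp : ∀ x, Y.q (p x) = 0) : ∃ T : V →L[𝕜] X, (∀ x, Y.j (T x) = p x) ∧ ‖T‖ ≤ ‖p‖ := by
  have h : ∀ x, ∃ z, Y.j z = p x := fun x => by
    have : p x ∈ LinearMap.range Y.j.toLinearMap := by rw [Y.range_j]; exact hp x
    exact this
  choose t ht using h
  let T : V →ₗ[𝕜] X :=
    { toFun := t
      map_add' := fun x y => Y.j.injective (by rw [map_add, ht, ht, ht, map_add])
      map_smul' := fun r x => Y.j.injective (by rw [map_smul, ht, ht, map_smul, RingHom.id_apply]) }
  refine ⟨T.mkContinuous ‖p‖ fun x => ?_, ht, LinearMap.mkContinuous_norm_le _ (norm_nonneg _) _⟩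
  rw [← Y.j.norm_map]
  exact (congrArg norm (ht x)).trans_le (p.le_opNorm x)

/-- A lifting `G` of a surjection `Q` whose restriction to `ker Q` extends to the whole space yields
a bounded right inverse. -/
theorem exists_section {F : Type*} [NormedAddCommGroup F] [NormedSpace 𝕜 F] (Q : F →L[𝕜] Z) {M : ℝ}
    (hM : 0 ≤ M) (hQ : ∀ e, ∃ f, Q f = e ∧ ‖f‖ ≤ M * ‖e‖) (G : F →L[𝕜] Y.space)
    (hG : ∀ f, Y.q (G f) = Q f) (T : F →L[𝕜] X)
    (hT : ∀ k : LinearMap.ker Q.toLinearMap, Y.j (T k) = G k) :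
    ∃ v : Z →L[𝕜] Y.space, Y.q ∘L v = ContinuousLinearMap.id 𝕜 Z ∧
      ‖v‖ ≤ (‖G‖ + ‖T‖) * M := by
  choose s hs hsn using hQ
  -- `S` vanishes on `ker Q`, so it factors through `Q`, and the factor is the right inverse.
  let S : F →L[𝕜] Y.space := G - Y.j.toContinuousLinearMap ∘L T
  have hS : ∀ x y, Q x = Q y → S x = S y := by
    intro x y hxy
    have hk : Q (x - y) = 0 := by rw [map_sub, hxy, sub_self]
    have h := hT ⟨x - y, hk⟩
    rw [← sub_eq_zero, ← map_sub]
    exact sub_eq_zero.2 h.symm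
  have hSn : ‖S‖ ≤ ‖G‖ + ‖T‖ := by
    refine (norm_sub_le _ _).trans ?_
    gcongr
    refine (ContinuousLinearMap.opNorm_comp_le _ _).trans ?_
    exact mul_le_of_le_one_left (norm_nonneg _) Y.j.norm_toContinuousLinearMap_le
  let v : Z →ₗ[𝕜] Y.space :=
    { toFun := fun e => S (s e)
      map_add' := fun x y => by
        rw [← map_add]
        exact hS _ _ (by rw [map_add, hs, hs, hs])
      map_smul' := fun r x => by
        rw [RingHom.id_apply, ← map_smul]
        exact hS _ _ (by rw [map_smul, hs, hs]) }
  refine ⟨v.mkContinuous ((‖G‖ + ‖T‖) * M) fun e => ?_, ?_,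
    LinearMap.mkContinuous_norm_le _ (by positivity) _⟩
  · change ‖S (s e)‖ ≤ _
    calc ‖S (s e)‖ ≤ (‖G‖ + ‖T‖) * (M * ‖e‖) :=
          (S.le_opNorm _).trans (mul_le_mul hSn (hsn e) (norm_nonneg _) (by positivity))
      _ = _ := by ring
  · ext e
    change Y.q (G (s e) - Y.j (T (s e))) = e
    rw [map_sub, hG, hs, Y.q_j, sub_zero]

/-- A bounded right inverse extends the restriction to `ker Q` of a lifting of `Q`. -/
theorem exists_extension_of_section {F : Type*} [NormedAddCommGroup F] [NormedSpace 𝕜 F]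
    (Q : F →L[𝕜] Z) (G : F →L[𝕜] Y.space) (hG : ∀ f, Y.q (G f) = Q f) (v : Z →L[𝕜] Y.space)
    (hv : Y.q ∘L v = ContinuousLinearMap.id 𝕜 Z) :
    ∃ T : F →L[𝕜] X, (∀ k : LinearMap.ker Q.toLinearMap, Y.j (T k) = G k) ∧
      ‖T‖ ≤ ‖G‖ + ‖v‖ * ‖Q‖ := by
  have hv' : ∀ e, Y.q (v e) = e := fun e => DFunLike.congr_fun hv e
  obtain ⟨T, hT, hTn⟩ := Y.exists_factor (G - v ∘L Q) fun x => by
    change Y.q (G x - v (Q x)) = 0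
    rw [map_sub, hG, hv', sub_self]
  refine ⟨T, fun k => ?_, hTn.trans ((norm_sub_le _ _).trans ?_)⟩
  · have hk : Q k = 0 := k.2
    rw [hT]
    change G k - v (Q k) = G k
    rw [hk, map_zero, sub_zero]
  · gcongr
    exact v.opNorm_comp_le Q

theorem spl_le_of_section {v : Z →L[𝕜] Y.space} (hv : Y.q ∘L v = ContinuousLinearMap.id 𝕜 Z) {B : ℝ}
    (hB : ‖v‖ ≤ B) : Y.spl ≤ ENNReal.ofReal √(B ^ 2 + (1 + B) ^ 2) := by
  refine (iInf_le _ ⟨v, hv⟩).trans (ENNReal.ofReal_le_ofReal (Real.sqrt_le_sqrt ?_))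
  have h : ‖ContinuousLinearMap.id 𝕜 Y.space - v ∘L Y.q‖ ≤ 1 + B := by
    refine (norm_sub_le _ _).trans (add_le_add ContinuousLinearMap.norm_id_le ?_)
    refine (v.opNorm_comp_le _).trans ((mul_le_of_le_one_right (norm_nonneg _) Y.norm_q_le).trans hB)
  gcongr

theorem exists_section_of_spl_lt {B : ℝ} (hB : Y.spl < ENNReal.ofReal B) :
    ∃ v : Z →L[𝕜] Y.space, Y.q ∘L v = ContinuousLinearMap.id 𝕜 Z ∧ ‖v‖ ≤ B := by
  obtain ⟨⟨v, hv⟩, h⟩ := iInf_lt_iff.1 hB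
  refine ⟨v, hv, ?_⟩
  rw [ENNReal.ofReal_lt_ofReal_iff_of_nonneg (Real.sqrt_nonneg _)] at h
  refine le_trans (Real.le_sqrt_of_sq_le ?_) h.le
  exact le_add_of_nonneg_right (sq_nonneg _)

end Basic

end TwistedSum

/-! ### Uniform constants and the equivalence -/

/-- If every operator from a subspace to a Banach space extends, then extensions can be chosen with
uniformly bounded norm. -/
theorem exists_uniform_extension {𝕜 F H : Type*} [RCLike 𝕜] [NormedAddCommGroup F]
    [NormedSpace 𝕜 F] [NormedAddCommGroup H] [NormedSpace 𝕜 H] [CompleteSpace H]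
    (K : Submodule 𝕜 F) (h : ∀ T : K →L[𝕜] H, ∃ T' : F →L[𝕜] H, T' ∘L K.subtypeL = T) :
    ∃ C : ℝ, 0 < C ∧ ∀ T : K →L[𝕜] H, ∃ T' : F →L[𝕜] H, T' ∘L K.subtypeL = T ∧
      ‖T'‖ ≤ C * ‖T‖ := by
  -- Restriction to `K` is a bounded surjection between Banach spaces of operators, so the open
  -- mapping theorem applies.
  obtain ⟨C, hC, hpre⟩ := ((ContinuousLinearMap.compL 𝕜 K F H).flip
    K.subtypeL).exists_preimage_norm_le h
  exact ⟨C, hC, hpre⟩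

/-- `ℓ²ₙ` is the range of a norm-one projection of `ℓ²`, so the constant does not depend on `n`. -/
theorem exists_extension_of_uniform_ellTwo {𝕜 F : Type*} [RCLike 𝕜] [NormedAddCommGroup F]
    [NormedSpace 𝕜 F] {K : Submodule 𝕜 F} {C : ℝ} (hC : 0 ≤ C)
    (h : ∀ T : K →L[𝕜] EllTwo 𝕜, ∃ T' : F →L[𝕜] EllTwo 𝕜, T' ∘L K.subtypeL = T ∧ ‖T'‖ ≤ C * ‖T‖)
    {n : ℕ} (T : K →L[𝕜] EuclideanSpace 𝕜 (Fin n)) :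
    ∃ T' : F →L[𝕜] EuclideanSpace 𝕜 (Fin n), T' ∘L K.subtypeL = T ∧ ‖T'‖ ≤ C * ‖T‖ := by
  obtain ⟨S, hS, hSn⟩ := h (ellTwoInclusion 𝕜 n ∘L T)
  refine ⟨ellTwoTruncate 𝕜 n ∘L S, ?_, ?_⟩
  · rw [ContinuousLinearMap.comp_assoc, hS]
    ext1 k
    exact ellTwoTruncate_ellTwoInclusion (T k)
  · refine ((ellTwoTruncate 𝕜 n).opNorm_comp_le S).trans ((mul_le_of_le_one_left (norm_nonneg _)
      (norm_ellTwoTruncate_le 𝕜 n)).trans (hSn.trans ?_))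
    gcongr
    exact ((ellTwoInclusion 𝕜 n).opNorm_comp_le T).trans
      (mul_le_of_le_one_left (norm_nonneg _) (norm_ellTwoInclusion_le 𝕜 n))

/-- Grothendieck's theorem makes the extension of each truncation summing with constant proportional
to `B`. The bound passes to the restriction and then to the limit in `n`. -/
theorem IsScriptLOneSpace.isAbsolutelySumming_of_extensions {𝕜 F : Type*} [RCLike 𝕜]
    [NormedAddCommGroup F] [NormedSpace 𝕜 F] (hF : IsScriptLOneSpace 𝕜 F) {K : Submodule 𝕜 F}
    (T : K →L[𝕜] EllTwo 𝕜) (B : ℝ) (h : ∀ n, 0 < n → ∃ T' : F →L[𝕜] EuclideanSpace 𝕜 (Fin n),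
      T' ∘L K.subtypeL = ellTwoTruncate 𝕜 n ∘L T ∧ ‖T'‖ ≤ B) : IsAbsolutelySumming T := by
  obtain ⟨C, hC, hsum⟩ := hF.exists_summingBound
  have hB : 0 ≤ B := by
    obtain ⟨T', -, hT'⟩ := h 1 one_pos
    exact (norm_nonneg _).trans hT'
  refine (isAbsolutelySumming_iff_exists_summingBound T).2 ⟨C * B, by positivity,
    summingBound_of_truncate fun n hn => ?_⟩
  obtain ⟨T', hT', hT'n⟩ := h n hn
  rw [← hT']
  intro m x c hc
  have hc0 : 0 ≤ c := by simpa using hc 0 (by simp)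
  refine ((hsum n T').comp_subtypeL K m x c hc).trans ?_
  gcongr

/-- Bounded right inverses for push-outs yield extensions of operators defined on the kernel. -/
theorem exists_extension_of_pushout_sections {𝕜 : Type w} [RCLike 𝕜] {F : Type*} {E : Type v}
    [NormedAddCommGroup F] [NormedSpace 𝕜 F] [CompleteSpace F] [NormedAddCommGroup E]
    [NormedSpace 𝕜 E] [CompleteSpace E] (Q : F →L[𝕜] E) (hQ : Function.Surjective Q) :
    ∃ a b : ℝ, 0 ≤ a ∧ 0 ≤ b ∧ ∀ {H : Type u} [NormedAddCommGroup H] [NormedSpace 𝕜 H]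
      [CompleteSpace H] (T : LinearMap.ker Q.toLinearMap →L[𝕜] H) (r : ℝ), ‖T‖ < r →
      ∃ Y : TwistedSum 𝕜 H E, ∀ v : E →L[𝕜] Y.space, Y.q ∘L v = ContinuousLinearMap.id 𝕜 E →
        ∃ T' : F →L[𝕜] H, T' ∘L (LinearMap.ker Q.toLinearMap).subtypeL = T ∧
          ‖T'‖ ≤ r * (a + b * ‖v‖) := by
  obtain ⟨c, hc, hpush⟩ := TwistedSum.exists_pushout Q hQ
  refine ⟨c⁻¹ * (c + ‖Q‖), c⁻¹ * ‖Q‖, by positivity, by positivity, fun {H} _ _ _ T r hr => ?_⟩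
  have hr0 : 0 < r := (norm_nonneg _).trans_lt hr
  have hr𝕜 : (r : 𝕜) ≠ 0 := by exact_mod_cast hr0.ne'
  have hc𝕜 : (c : 𝕜) ≠ 0 := by exact_mod_cast hc.ne'
  -- The push-out needs a contraction. Dividing by some `r > ‖T‖` also covers `T = 0`.
  obtain ⟨Y, G, hGn, hG, hGT⟩ := hpush ((r : 𝕜)⁻¹ • T) (by
    rw [norm_smul, norm_inv, RCLike.norm_ofReal, abs_of_pos hr0, inv_mul_le_iff₀ hr0, mul_one]
    exact hr.le)
  refine ⟨Y, fun v hv => ?_⟩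
  obtain ⟨S, hS, hSn⟩ := Y.exists_extension_of_section Q G hG v hv
  refine ⟨((r : 𝕜) * (c : 𝕜)⁻¹) • S, ?_, ?_⟩
  · ext1 k
    have h : S k = (c : 𝕜) • (r : 𝕜)⁻¹ • T k := Y.j.injective ((hS k).trans (hGT k))
    change ((r : 𝕜) * (c : 𝕜)⁻¹) • S k = T k
    have hone : (r : 𝕜) * (c : 𝕜)⁻¹ * (c : 𝕜) * (r : 𝕜)⁻¹ = 1 := by field_simp
    rw [h, smul_smul, smul_smul]
    exact (congrArg (· • T k) hone).trans (one_smul 𝕜 _)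
  · rw [norm_smul, norm_mul, norm_inv, RCLike.norm_ofReal, RCLike.norm_ofReal, abs_of_pos hr0,
      abs_of_pos hc]
    calc r * c⁻¹ * ‖S‖ ≤ r * c⁻¹ * ((c + ‖Q‖) + ‖v‖ * ‖Q‖) := by
          gcongr
          exact hSn.trans (by gcongr)
      _ = _ := by ring

/-- Extendability of operators on the kernel of `Q` yields bounded right inverses of the quotient
map of every twisted sum with a Hilbert space. -/
theorem IsScriptLOneSpace.exists_section_of_extensions {𝕜 : Type w} [RCLike 𝕜] {F : Type*}
    {E : Type v} [NormedAddCommGroup F] [NormedSpace 𝕜 F] [CompleteSpace F]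
    (hF : IsScriptLOneSpace 𝕜 F) [NormedAddCommGroup E] [NormedSpace 𝕜 E] [CompleteSpace E]
    (Q : F →L[𝕜] E) (hQ : Function.Surjective Q) {C : ℝ} (hC : 0 ≤ C) :
    ∃ B : ℝ, ∀ {H : Type u} [NormedAddCommGroup H] [InnerProductSpace 𝕜 H] [CompleteSpace H]
      (_ : ∀ T : LinearMap.ker Q.toLinearMap →L[𝕜] H, ∃ T' : F →L[𝕜] H,
        T' ∘L (LinearMap.ker Q.toLinearMap).subtypeL = T ∧ ‖T'‖ ≤ C * ‖T‖)
      (Y : TwistedSum 𝕜 H E), ∃ v : E →L[𝕜] Y.space,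
        Y.q ∘L v = ContinuousLinearMap.id 𝕜 E ∧ ‖v‖ ≤ B := by
  obtain ⟨M, hM, hpre⟩ := Q.exists_preimage_norm_le hQ
  obtain ⟨L, hL, hlift⟩ := hF.exists_lift
  refine ⟨(L * ‖Q‖ + C * (L * ‖Q‖)) * M, fun {H} _ _ _ hext Y => ?_⟩
  obtain ⟨G, hG, hGn⟩ := hlift Y.j Y.q Y.range_j Y.exists_preimage Q
  have hG' : ∀ f, Y.q (G f) = Q f := fun f => DFunLike.congr_fun hG f
  obtain ⟨T, hT, hTn⟩ := Y.exists_factor (G ∘L (LinearMap.ker Q.toLinearMap).subtypeL)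
    fun k => (hG' k).trans k.2
  obtain ⟨T', hT', hT'n⟩ := hext T
  obtain ⟨v, hv, hvn⟩ := Y.exists_section Q hM.le hpre G hG' T' fun k =>
    (congrArg Y.j (DFunLike.congr_fun hT' k)).trans (hT k)
  refine ⟨v, hv, hvn.trans ?_⟩
  have h1 : ‖T‖ ≤ L * ‖Q‖ := by
    refine hTn.trans ((G.opNorm_comp_le _).trans ?_)
    exact (mul_le_of_le_one_right (norm_nonneg _) (Submodule.norm_subtypeL_le _)).trans hGn
  gcongr
  exact hT'n.trans (by gcongr)

theorem theorem3p1 (𝕜 : Type*) [RCLike 𝕜]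
    (E : Type*) [NormedAddCommGroup E] [NormedSpace 𝕜 E] [CompleteSpace E]
    (F : Type*) [NormedAddCommGroup F] [NormedSpace 𝕜 F] [CompleteSpace F]
    (hF : IsScriptLOneSpace 𝕜 F)
    (Q : F →L[𝕜] E) (hQ : Function.Surjective Q) :
    List.TFAE [
      IsGTSpace 𝕜 (LinearMap.ker Q.toLinearMap),
      ∀ Y : TwistedSum 𝕜 (EllTwo 𝕜) E, Y.Splits,
      (⨆ (n : ℕ) (_ : 0 < n) (Y : TwistedSum 𝕜 (EuclideanSpace 𝕜 (Fin n)) E), Y.spl) < ⊤] := by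
  have hext : IsGTSpace 𝕜 (LinearMap.ker Q.toLinearMap) → ∃ C : ℝ, 0 < C ∧
      ∀ T : LinearMap.ker Q.toLinearMap →L[𝕜] EllTwo 𝕜, ∃ T' : F →L[𝕜] EllTwo 𝕜,
        T' ∘L (LinearMap.ker Q.toLinearMap).subtypeL = T ∧ ‖T'‖ ≤ C * ‖T‖ := fun h =>
    exists_uniform_extension _ fun T => by
      obtain ⟨C, hC, hT⟩ := (isAbsolutelySumming_iff_exists_summingBound T).1 (h T)
      exact hT.exists_extension hC
  obtain ⟨a, b, ha, hb, hpush⟩ := exists_extension_of_pushout_sections Q hQ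
  tfae_have 1 → 2 := by
    intro h Y
    obtain ⟨C, hC, hext⟩ := hext h
    obtain ⟨B, hB⟩ := hF.exists_section_of_extensions Q hQ hC.le
    obtain ⟨v, hv, -⟩ := hB hext Y
    exact ⟨v, hv⟩
  tfae_have 1 → 3 := by
    intro h
    obtain ⟨C, hC, hext⟩ := hext h
    obtain ⟨B, hB⟩ := hF.exists_section_of_extensions Q hQ hC.le
    refine lt_of_le_of_lt (iSup_le fun n => iSup_le fun _ => iSup_le fun Y => ?_)
      (ENNReal.ofReal_lt_top (r := √(B ^ 2 + (1 + B) ^ 2)))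
    obtain ⟨v, hv, hvB⟩ := hB (exists_extension_of_uniform_ellTwo hC.le hext) Y
    exact Y.spl_le_of_section hv hvB
  tfae_have 2 → 1 := by
    intro h T
    obtain ⟨Y, hY⟩ := hpush T (‖T‖ + 1) (lt_add_one _)
    obtain ⟨v, hv⟩ := h Y
    obtain ⟨T', hT', -⟩ := hY v hv
    refine hF.isAbsolutelySumming_of_extensions T ‖T'‖ fun n _ =>
      ⟨ellTwoTruncate 𝕜 n ∘L T', by rw [ContinuousLinearMap.comp_assoc, hT'], ?_⟩
    exact (ContinuousLinearMap.opNorm_comp_le _ _).trans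
      (mul_le_of_le_one_left (norm_nonneg _) (norm_ellTwoTruncate_le 𝕜 n))
  tfae_have 3 → 1 := by
    intro h T
    obtain ⟨B, hB⟩ : ∃ B : ℝ, (⨆ (n : ℕ) (_ : 0 < n)
        (Y : TwistedSum 𝕜 (EuclideanSpace 𝕜 (Fin n)) E), Y.spl) < ENNReal.ofReal B := by
      obtain ⟨B, hB, -⟩ := ENNReal.lt_iff_exists_nnreal_btwn.1 h
      exact ⟨B, by rwa [ENNReal.ofReal_coe_nnreal]⟩
    -- The push-outs along the truncations of `T` vary with `n`, but the constants `a`, `b`, `B` and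
    -- the radius `‖T‖ + 1` do not.
    refine hF.isAbsolutelySumming_of_extensions T ((‖T‖ + 1) * (a + b * B)) fun n hn => ?_
    obtain ⟨Y, hY⟩ := hpush (ellTwoTruncate 𝕜 n ∘L T) (‖T‖ + 1) (lt_of_le_of_lt
      ((ContinuousLinearMap.opNorm_comp_le _ _).trans (mul_le_of_le_one_left (norm_nonneg _)
        (norm_ellTwoTruncate_le 𝕜 n))) (lt_add_one _))
    have hspl : Y.spl < ENNReal.ofReal B := lt_of_le_of_lt
      (le_iSup_of_le n (le_iSup_of_le hn (le_iSup_of_le Y le_rfl))) hB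
    obtain ⟨v, hv, hvB⟩ := Y.exists_section_of_spl_lt hspl
    obtain ⟨T', hT', hT'n⟩ := hY v hv
    exact ⟨T', hT', hT'n.trans (by gcongr)⟩
  tfae_finish
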